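/- Let $R$ be a field, let $X$ be a topological space, and let $\mathcal U=(U_i)_{i\in I}$ be a finite cover of $X$ by open subsets. For a finite non-empty set $\sigma\subseteq I$ write $U_\sigma=\bigcap_{i\in\sigma}U_i$. The nerve $N_{\mathcal U}$ is the abstract simplicial complex whose simplices are the $\sigma$ with $U_\sigma\neq\emptyset$, where $\sigma$ has dimension $|\sigma|-1$. Write $H^n(-;R)$ for singular cohomology with coefficients in $R$. For $n\ge 0$ let $\mathcal C^n$ be the Čech cellular sheaf on $N_{\mathcal U}$, which assigns to each simplex $\sigma$ the $R$-vector space $\mathcal C^n(\sigma)=H^n(U_\sigma;R)$ and to each face relation $\sigma\subseteq\tau$ the linear map $\mathcal C^n_{\sigma\tau}:H^n(U_\sigma;R)\to H^n(U_\tau;R)$ induced by the inclusion $U_\tau\hookrightarrow U_\sigma$; put $\mathcal C^{-1}=0$. For a cellular sheaf $\mathcal F$ on $N_{\mathcal U}$, let $H^k(N_{\mathcal U};\mathcal F)=\ker\delta^k/\operatorname{im}\delta^{k-1}$ be the cohomology of the complex with cochain groups $C^k(N_{\mathcal U};\mathcal F)=\bigoplus_{\dim\sigma=k}\mathcal F(\sigma)$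 and $C^{-1}(N_{\mathcal U};\mathcal F)=0$, where the component of $\delta^k$ from $\mathcal F(\sigma)$ to $\mathcal F(\tau)$ is $[\sigma:\tau]\,\mathcal F_{\sigma\tau}$. Here the incidence numbers $[\sigma:\tau]\in\{0,\pm1\}$ come from orienting the simplices by a linear order on $I$: $[\sigma:\tau]=(-1)^j$ if $\sigma$ is obtained from $\tau$ by deleting its $j$-th vertex in increasing order, counted from $0$, and $[\sigma:\tau]=0$ if $\sigma$ is not a codimension-one face of $\tau$. Suppose that $N_{\mathcal U}$ is at most one-dimensional, i.e. that every simplex of $N_{\mathcal U}$ has at most two vertices. Then, for every linear order on $I$ and every integer $n\ge 0$, there is an isomorphism of $R$-vector spaces \[ H^n(X;R)\;\cong\;H^0(N_{\mathcal U};\mathcal C^n)\oplus H^1(N_{\mathcal U};\mathcal C^{n-1}). \] In particular, for $n=0$ this reads $H^0(X;R)\cong H^0(N_{\mathcal U};\mathcal C^0)$. -/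

import Mathlib

open CategoryTheory

universe u v w

/-! ### Cohomology of a sequence of linear maps `C 0 → C 1 → C 2 → ⋯` -/

namespace CochainSeq

/-- The coboundaries `im (d (n - 1)) ⊆ C n`, with the convention `C (-1) = 0`. -/
def coboundaries {R : Type v} [Ring R] {C : ℕ → Type w} [∀ n, AddCommGroup (C n)]
    [∀ n, Module R (C n)] (d : ∀ n, C n →ₗ[R] C (n + 1)) : ∀ n, Submodule R (C n)
  | 0 => ⊥
  | n + 1 => LinearMap.range (d n)

/-- The `n`-th cohomology `ker (d n) / im (d (n - 1))`. -/
abbrev Cohomology {R : Type v} [Ring R] {C : ℕ → Type w} [∀ n, AddCommGroup (C n)]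
    [∀ n, Module R (C n)] (d : ∀ n, C n →ₗ[R] C (n + 1)) (n : ℕ) : Type w :=
  LinearMap.ker (d n) ⧸ (coboundaries d n).submoduleOf (LinearMap.ker (d n))

theorem map_mem_ker {R : Type v} [Ring R] {C D : ℕ → Type w}
    [∀ n, AddCommGroup (C n)] [∀ n, Module R (C n)]
    [∀ n, AddCommGroup (D n)] [∀ n, Module R (D n)]
    {d : ∀ n, C n →ₗ[R] C (n + 1)} {d' : ∀ n, D n →ₗ[R] D (n + 1)}
    (φ : ∀ n, C n →ₗ[R] D n) (hφ : ∀ n c, φ (n + 1) (d n c) = d' n (φ n c)) (n : ℕ) :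
    ∀ c ∈ LinearMap.ker (d n), φ n c ∈ LinearMap.ker (d' n) := by
  intro c hc
  rw [LinearMap.mem_ker] at hc ⊢
  rw [← hφ, hc, map_zero]

theorem map_mem_coboundaries {R : Type v} [Ring R] {C D : ℕ → Type w}
    [∀ n, AddCommGroup (C n)] [∀ n, Module R (C n)]
    [∀ n, AddCommGroup (D n)] [∀ n, Module R (D n)]
    {d : ∀ n, C n →ₗ[R] C (n + 1)} {d' : ∀ n, D n →ₗ[R] D (n + 1)}
    (φ : ∀ n, C n →ₗ[R] D n) (hφ : ∀ n c, φ (n + 1) (d n c) = d' n (φ n c)) (n : ℕ) :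
    ∀ c ∈ coboundaries d n, φ n c ∈ coboundaries d' n := by
  cases n with
  | zero =>
    intro c hc
    have hc' : c = 0 := hc
    rw [hc', map_zero]
    exact Submodule.zero_mem _
  | succ n =>
    rintro _ ⟨b, rfl⟩
    exact ⟨φ n b, (hφ n b).symm⟩

/-- The map induced on cohomology by a cochain map: `[c] ↦ [φ c]`. -/
def cohomologyMap {R : Type v} [Ring R] {C D : ℕ → Type w}
    [∀ n, AddCommGroup (C n)] [∀ n, Module R (C n)]
    [∀ n, AddCommGroup (D n)] [∀ n, Module R (D n)]
    {d : ∀ n, C n →ₗ[R] C (n + 1)} {d' : ∀ n, D n →ₗ[R] D (n + 1)}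
    (φ : ∀ n, C n →ₗ[R] D n) (hφ : ∀ n c, φ (n + 1) (d n c) = d' n (φ n c)) (n : ℕ) :
    Cohomology d n →ₗ[R] Cohomology d' n :=
  Submodule.mapQ _ _ ((φ n).restrict (map_mem_ker φ hφ n))
    (fun c hc => map_mem_coboundaries φ hφ n c.1 hc)

end CochainSeq

/-! ### Singular cohomology -/

namespace Singular

/-- The inclusion of the `i`-th face of the standard topological `(n + 1)`-simplex. -/
noncomputable def faceInclusion (n : ℕ) (i : Fin (n + 2)) :
    C(stdSimplex ℝ (Fin (n + 1)), stdSimplex ℝ (Fin (n + 2))) :=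
  ⟨stdSimplex.map i.succAbove, stdSimplex.continuous_map _⟩

/-- Singular `n`-cochains of `X` with values in `R`: functions on the set of singular
`n`-simplices of `X` (equivalently, homomorphisms from singular `n`-chains to `R`). -/
abbrev Cochain (R : Type v) (X : Type u) [TopologicalSpace X] (n : ℕ) : Type (max u v) :=
  C(stdSimplex ℝ (Fin (n + 1)), X) → R

/-- The singular coboundary `(δ c)(s) = ∑ i, (-1)ⁱ c(∂ᵢ s)`. -/
noncomputable def coboundary (R : Type v) [Ring R] (X : Type u) [TopologicalSpace X] (n : ℕ) :
    Cochain R X n →ₗ[R] Cochain R X (n + 1) where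
  toFun c s := ∑ i : Fin (n + 2), (-1 : ℤ) ^ (i : ℕ) • c (s.comp (faceInclusion n i))
  map_add' c c' := by
    funext s
    simp [Finset.sum_add_distrib]
  map_smul' r c := by
    funext s
    simp only [Pi.smul_apply, RingHom.id_apply, Finset.smul_sum]
    exact Finset.sum_congr rfl fun i _ => (smul_comm r ((-1 : ℤ) ^ (i : ℕ)) _).symm

/-- The singular cohomology `Hⁿ(X; R)`. -/
abbrev Cohomology (R : Type v) [Ring R] (X : Type u) [TopologicalSpace X] (n : ℕ) :
    Type (max u v) :=
  CochainSeq.Cohomology (coboundary R X) n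

/-- Pull-back of singular cochains along a continuous map `f`: `(f* c)(s) = c (f ∘ s)`. -/
def pullback (R : Type v) [Ring R] {X Y : Type u} [TopologicalSpace X] [TopologicalSpace Y]
    (f : C(X, Y)) (n : ℕ) : Cochain R Y n →ₗ[R] Cochain R X n :=
  LinearMap.funLeft R R (fun s => f.comp s)

theorem pullback_coboundary (R : Type v) [Ring R] {X Y : Type u} [TopologicalSpace X]
    [TopologicalSpace Y] (f : C(X, Y)) (n : ℕ) (c : Cochain R Y n) :
    pullback R f (n + 1) (coboundary R Y n c) = coboundary R X n (pullback R f n c) := by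
  funext s
  rfl

/-- The map `f* : Hⁿ(Y; R) → Hⁿ(X; R)` induced by a continuous map `f : X → Y`. -/
noncomputable def cohomologyMap (R : Type v) [Ring R] {X Y : Type u} [TopologicalSpace X]
    [TopologicalSpace Y] (f : C(X, Y)) (n : ℕ) : Cohomology R Y n →ₗ[R] Cohomology R X n :=
  CochainSeq.cohomologyMap (pullback R f) (pullback_coboundary R f) n

theorem cohomologyMap_id (R : Type v) [Ring R] (X : Type u) [TopologicalSpace X] (n : ℕ) :
    cohomologyMap R (ContinuousMap.id X) n = LinearMap.id := by
  refine Submodule.linearMap_qext _ (LinearMap.ext fun c => ?_)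
  rfl

theorem cohomologyMap_comp (R : Type v) [Ring R] {X Y Z : Type u} [TopologicalSpace X]
    [TopologicalSpace Y] [TopologicalSpace Z] (g : C(Y, Z)) (f : C(X, Y)) (n : ℕ) :
    cohomologyMap R (g.comp f) n = cohomologyMap R f n ∘ₗ cohomologyMap R g n := by
  refine Submodule.linearMap_qext _ (LinearMap.ext fun c => ?_)
  rfl

end Singular

/-! ### Cellular sheaves on abstract simplicial complexes -/

/-- A cellular sheaf of `R`-modules on an abstract simplicial complex `K`: a functor from the
poset of simplices of `K` (ordered by the face relation) to `R`-modules. Thus `F.obj σ` is the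
module on `σ`, and `F.map` gives the restriction map `F.obj σ ⟶ F.obj τ` for `σ ≤ τ`. -/
abbrev CellularSheaf (R : Type v) [Ring R] {ι : Type*} (K : PreAbstractSimplicialComplex ι) :=
  K.faces ⥤ ModuleCat.{w} R

namespace CellularSheaf

/-- The simplices of dimension `k` of `K`, i.e. those with `k + 1` vertices. -/
abbrev Simplex {ι : Type*} (K : PreAbstractSimplicialComplex ι) (k : ℕ) :=
  {σ : K.faces // σ.1.card = k + 1}

/-- The face of a `(k + 1)`-simplex `τ` opposite to its vertex `i`. -/
def facet {ι : Type*} [DecidableEq ι] {K : PreAbstractSimplicialComplex ι} {k : ℕ}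
    (τ : Simplex K (k + 1)) (i : τ.1.1) : Simplex K k :=
  have hcard : (τ.1.1.erase i.1).card = k + 1 := by
    rw [Finset.card_erase_of_mem i.2, τ.2]; rfl
  ⟨⟨τ.1.1.erase i.1, K.isRelLowerSet_faces.mem_of_le τ.1.2 (Finset.erase_subset _ _)
    (Finset.card_pos.1 (by omega))⟩, hcard⟩

theorem facet_le {ι : Type*} [DecidableEq ι] {K : PreAbstractSimplicialComplex ι} {k : ℕ}
    (τ : Simplex K (k + 1)) (i : τ.1.1) : (facet τ i).1 ≤ τ.1 :=
  Finset.erase_subset _ _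

/-- The incidence number `[σ : τ] = ±1` of the face `σ` of `τ` opposite to the vertex `i`, for the
orientations of simplices induced by the linear order on vertices: it is `(-1) ^ j`, where `j` is
the position of `i` among the vertices of `τ` listed in increasing order, starting from `0`. -/
def incidence {ι : Type*} [LinearOrder ι] {K : PreAbstractSimplicialComplex ι} {k : ℕ}
    (τ : Simplex K (k + 1)) (i : τ.1.1) : ℤ :=
  (-1) ^ (τ.1.1.filter (· < i.1)).card

/-- The `k`-cochains of a cellular sheaf (for finite `K`, this product is the direct sum of the
modules on the `k`-simplices). -/
abbrev Cochain {R : Type v} [Ring R] {ι : Type*} {K : PreAbstractSimplicialComplex ι}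
    (F : CellularSheaf.{v, w} R K) (k : ℕ) :=
  ∀ σ : Simplex K k, F.obj σ.1

/-- The coboundary of a cellular sheaf, whose component from `F σ` to `F τ` is the restriction map
multiplied by `[σ : τ]`. -/
def coboundary {R : Type v} [Ring R] {ι : Type*} [LinearOrder ι]
    {K : PreAbstractSimplicialComplex ι} (F : CellularSheaf.{v, w} R K) (k : ℕ) :
    Cochain F k →ₗ[R] Cochain F (k + 1) :=
  LinearMap.pi fun τ => ∑ i : τ.1.1,
    incidence τ i • ((F.map (homOfLE (facet_le τ i))).hom ∘ₗ LinearMap.proj (facet τ i))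

/-- The cohomology `Hᵏ(K; F)` of `K` with coefficients in the cellular sheaf `F`. -/
abbrev Cohomology {R : Type v} [Ring R] {ι : Type*} [LinearOrder ι]
    {K : PreAbstractSimplicialComplex ι} (F : CellularSheaf.{v, w} R K) (k : ℕ) :=
  CochainSeq.Cohomology (coboundary F) k

end CellularSheaf

/-! ### The nerve of a cover and its Čech cellular sheaves -/

/-- The support `U_σ = ⋂ i ∈ σ, U i` of a finite set `σ` of members of a cover. -/
def coverSupport {ι : Type*} {X : Type u} (U : ι → Set X) (σ : Finset ι) : Set X :=
  ⋂ i ∈ σ, U i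

theorem coverSupport_anti {ι : Type*} {X : Type u} (U : ι → Set X) {σ τ : Finset ι}
    (h : σ ⊆ τ) : coverSupport U τ ⊆ coverSupport U σ :=
  Set.biInter_subset_biInter_left h

/-- The nerve of a family of sets: its simplices are the non-empty finite sets of indices with
non-empty support. -/
def coverNerve {ι : Type*} {X : Type u} (U : ι → Set X) : PreAbstractSimplicialComplex ι where
  faces := {σ | σ.Nonempty ∧ (coverSupport U σ).Nonempty}
  isRelLowerSet_faces := fun _ hσ =>
    ⟨hσ.1, fun _ hτσ hτ => ⟨hτ, hσ.2.mono (coverSupport_anti U hτσ)⟩⟩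

/-- The Čech cellular sheaf `𝒞ⁿ` on the nerve: `σ ↦ Hⁿ(U_σ; R)`, with restriction maps induced by
the inclusions of supports. -/
noncomputable def cechSheaf (R : Type v) [Ring R] {ι : Type*} {X : Type u} [TopologicalSpace X]
    (U : ι → Set X) (n : ℕ) : CellularSheaf.{v, max u v} R (coverNerve U) where
  obj σ := ModuleCat.of R (Singular.Cohomology R (coverSupport U σ.1) n)
  map {_ _} f := ModuleCat.ofHom
    (Singular.cohomologyMap R (ContinuousMap.inclusion (coverSupport_anti U (leOfHom f))) n)
  map_id σ := ModuleCat.hom_ext (Singular.cohomologyMap_id R (coverSupport U σ.1) n)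
  map_comp {_ _ _} f g := ModuleCat.hom_ext (Singular.cohomologyMap_comp R
    (ContinuousMap.inclusion (coverSupport_anti U (leOfHom f)))
    (ContinuousMap.inclusion (coverSupport_anti U (leOfHom g))) n)

/-! Consider the double complex of singular cochains on the supports `U_σ`. No point lies in three
members of the cover, so it has only two columns, vertices and edges. In each degree `n` its row,
augmented by the cochains on `X`, is exact: edge families lift to vertex families
(`Cech.horizontal_surjective`), and vertex families that agree on overlaps glue
(`Cech.exists_augmentation_eq`). The augmentation is not injective, but its kernel, the cochains
vanishing on simplices contained in some `U i`, is acyclic by barycentric subdivision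
(`Singular.exists_coboundary_eq_of_small`).

The rest is the Mayer–Vietoris argument, carried out by hand. Restriction to the vertices,
`Cech.toVertices`, has as image the kernel of the Čech coboundary, which is H⁰ of the sheaf
(`Cech.range_toVertices`). It is injective in degree `0`. In degree `n + 1` its kernel is identified
with H¹ of the sheaf in degree `n` through a linear relation instead of a connecting map. A pair
`(c, b)`, where `b` bounds the restrictions of the cocycle `c`, is sent both to the class of `c` and
to the class of the Čech differential of `b`. The first map has image `ker toVertices`, the second
is onto, and the two kernels agree (`Cech.ker_fstClass_eq_ker_sndClass`). Over a field the resulting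
extension splits. -/

/-! ### Chains on tuples of points, and their barycentric subdivision

A `k`-tuple of points stands for a simplex with `k` vertices; the complex is augmented, with the
empty tuple in the lowest degree. -/

/-- Formal `R`-linear combinations of `k`-tuples of points of `E`. -/
abbrev TupleChain (R : Type v) [CommRing R] (E : Type u) (k : ℕ) : Type (max u v) :=
  (Fin k → E) →₀ R

namespace TupleChain

variable {R : Type v} [CommRing R] {E : Type u} {E' : Type w}

/-- The alternating sum of the facets of a tuple. -/
noncomputable def boundary (k : ℕ) : TupleChain R E (k + 1) →ₗ[R] TupleChain R E k :=
  Finsupp.linearCombination R fun v =>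
    ∑ i : Fin (k + 1), (-1 : ℤ) ^ (i : ℕ) • Finsupp.single (v ∘ i.succAbove) (1 : R)

/-- The cone with apex `a`. -/
noncomputable def cone (a : E) (k : ℕ) : TupleChain R E k →ₗ[R] TupleChain R E (k + 1) :=
  Finsupp.lmapDomain R R fun v => (Fin.cons a v : Fin (k + 1) → E)

/-- The map induced by a map of sets of points. -/
noncomputable def map (f : E → E') (k : ℕ) : TupleChain R E k →ₗ[R] TupleChain R E' k :=
  Finsupp.lmapDomain R R (f ∘ ·)

theorem boundary_single (k : ℕ) (v : Fin (k + 1) → E) :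
    boundary k (Finsupp.single v (1 : R)) =
      ∑ i : Fin (k + 1), (-1 : ℤ) ^ (i : ℕ) • Finsupp.single (v ∘ i.succAbove) (1 : R) := by
  simp [boundary]

@[simp]
theorem cone_single (a : E) (k : ℕ) (v : Fin k → E) (r : R) :
    cone a k (Finsupp.single v r) = Finsupp.single (Fin.cons a v : Fin (k + 1) → E) r := by
  simp [cone]

@[simp]
theorem map_single (f : E → E') (k : ℕ) (v : Fin k → E) (r : R) :
    map f k (Finsupp.single v r) = Finsupp.single (f ∘ v) r := by
  simp [map]

/-- Linear maps out of tuple chains agree if they agree on tuples. -/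
theorem hom_ext {M : Type*} [AddCommGroup M] [Module R M] {α : Type*} {f g : (α →₀ R) →ₗ[R] M}
    (h : ∀ a, f (Finsupp.single a 1) = g (Finsupp.single a 1)) : f = g :=
  Finsupp.lhom_ext' fun a => LinearMap.ext_ring (h a)

theorem cons_comp_succAbove_succ {k : ℕ} (a : E) (v : Fin (k + 1) → E) (i : Fin (k + 1)) :
    (Fin.cons a v : Fin (k + 2) → E) ∘ i.succ.succAbove = Fin.cons a (v ∘ i.succAbove) := by
  funext j
  refine Fin.cases ?_ (fun j => ?_) j <;> simp

theorem boundary_cone_zero (a : E) (x : TupleChain R E 0) : boundary 0 (cone a 0 x) = x := by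
  suffices h : boundary 0 ∘ₗ cone (R := R) a 0 = LinearMap.id from LinearMap.congr_fun h x
  refine hom_ext fun v => ?_
  simp only [LinearMap.comp_apply, cone_single, boundary_single, LinearMap.id_apply]
  rw [Fin.sum_univ_one]
  simp [Subsingleton.elim _ v]

theorem boundary_cone_succ (a : E) (k : ℕ) (x : TupleChain R E (k + 1)) :
    boundary (k + 1) (cone a (k + 1) x) = x - cone a k (boundary k x) := by
  suffices h : boundary (k + 1) ∘ₗ cone (R := R) a (k + 1) =
      LinearMap.id - cone a k ∘ₗ boundary k from LinearMap.congr_fun h x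
  refine hom_ext fun v => ?_
  simp only [LinearMap.comp_apply, cone_single, boundary_single, LinearMap.id_apply,
    LinearMap.sub_apply, map_sum, map_zsmul]
  rw [Fin.sum_univ_succ, sub_eq_add_neg, ← Finset.sum_neg_distrib]
  congr 1
  · simp only [Fin.val_zero, pow_zero, one_smul]
    congr 1
  · refine Finset.sum_congr rfl fun i _ => ?_
    rw [cons_comp_succAbove_succ, Fin.val_succ, pow_succ, mul_neg_one, neg_smul]

theorem boundary_boundary (k : ℕ) (x : TupleChain R E (k + 2)) :
    boundary k (boundary (k + 1) x) = 0 := by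
  suffices h : boundary (R := R) (E := E) k ∘ₗ boundary (k + 1) = 0 from LinearMap.congr_fun h x
  refine hom_ext fun v => ?_
  -- Every non-empty tuple is the cone over its tail with apex `v 0`, so the cone formula applies.
  rw [LinearMap.comp_apply, ← Fin.cons_self_tail v, ← cone_single, boundary_cone_succ, map_sub]
  cases k with
  | zero => rw [boundary_cone_zero, sub_self, LinearMap.zero_apply]
  | succ k =>
    rw [boundary_cone_succ, boundary_boundary k, map_zero, sub_zero, sub_self,
      LinearMap.zero_apply]

theorem map_boundary (f : E → E') (k : ℕ) (x : TupleChain R E (k + 1)) :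
    map f k (boundary k x) = boundary k (map f (k + 1) x) := by
  suffices h : map (R := R) f k ∘ₗ boundary k = boundary k ∘ₗ map f (k + 1) from
    LinearMap.congr_fun h x
  refine hom_ext fun v => ?_
  simp [boundary_single, Function.comp_assoc]

theorem map_cone (f : E → E') (a : E) (k : ℕ) (x : TupleChain R E k) :
    map f (k + 1) (cone a k x) = cone (f a) k (map f k x) := by
  suffices h : map (R := R) f (k + 1) ∘ₗ cone a k = cone (f a) k ∘ₗ map f k from
    LinearMap.congr_fun h x
  refine hom_ext fun v => ?_
  simp only [LinearMap.comp_apply, cone_single, map_single]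
  congr 1
  funext j
  refine Fin.cases ?_ (fun j => ?_) j <;> simp

/-- The subdivision operator, for a given choice `b` of "barycenters" of tuples. -/
noncomputable def subdiv (b : ∀ k, (Fin (k + 1) → E) → E) :
    ∀ k, TupleChain R E k →ₗ[R] TupleChain R E k
  | 0 => LinearMap.id
  | k + 1 => Finsupp.linearCombination R fun v =>
      cone (b k v) k (subdiv b k (boundary k (Finsupp.single v 1)))

/-- The chain homotopy between the identity and the subdivision operator. -/
noncomputable def subdivHomotopy (b : ∀ k, (Fin (k + 1) → E) → E) :
    ∀ k, TupleChain R E k →ₗ[R] TupleChain R E (k + 1)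
  | 0 => 0
  | k + 1 => Finsupp.linearCombination R fun v => cone (b k v) (k + 1)
      (Finsupp.single v 1 - subdivHomotopy b k (boundary k (Finsupp.single v 1)))

section subdiv

variable (b : ∀ k, (Fin (k + 1) → E) → E) (b' : ∀ k, (Fin (k + 1) → E') → E')

theorem subdiv_single (k : ℕ) (v : Fin (k + 1) → E) :
    subdiv b (k + 1) (Finsupp.single v (1 : R)) =
      cone (b k v) k (subdiv b k (boundary k (Finsupp.single v 1))) := by
  simp [subdiv]

theorem subdivHomotopy_single (k : ℕ) (v : Fin (k + 1) → E) :
    subdivHomotopy b (k + 1) (Finsupp.single v (1 : R)) = cone (b k v) (k + 1)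
      (Finsupp.single v 1 - subdivHomotopy b k (boundary k (Finsupp.single v 1))) := by
  simp [subdivHomotopy]

theorem boundary_subdiv (k : ℕ) (x : TupleChain R E (k + 1)) :
    boundary k (subdiv b (k + 1) x) = subdiv b k (boundary k x) := by
  suffices h : boundary (R := R) k ∘ₗ subdiv b (k + 1) = subdiv b k ∘ₗ boundary k from
    LinearMap.congr_fun h x
  refine hom_ext fun v => ?_
  rw [LinearMap.comp_apply, LinearMap.comp_apply, subdiv_single]
  cases k with
  | zero => rw [boundary_cone_zero]
  | succ k => rw [boundary_cone_succ, boundary_subdiv k, boundary_boundary, map_zero, map_zero,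
      sub_zero]

/-- Write T for the homotopy and S for subdivision. The cone formula gives ∂Tv = v - T∂v - cone(∂v -
∂T∂v). By induction and ∂∂ = 0, the argument of the last cone is S∂v, and the cone over it is Sv. -/
theorem boundary_subdivHomotopy (k : ℕ) (x : TupleChain R E (k + 1)) :
    boundary (k + 1) (subdivHomotopy b (k + 1) x) + subdivHomotopy b k (boundary k x) =
      x - subdiv b (k + 1) x := by
  suffices h : boundary (R := R) (k + 1) ∘ₗ subdivHomotopy b (k + 1) +
      subdivHomotopy b k ∘ₗ boundary k = LinearMap.id - subdiv b (k + 1) from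
    LinearMap.congr_fun h x
  refine hom_ext fun v => ?_
  simp only [LinearMap.add_apply, LinearMap.comp_apply, LinearMap.sub_apply, LinearMap.id_apply]
  rw [subdivHomotopy_single, subdiv_single, boundary_cone_succ, map_sub (boundary (R := R) (E := E) k)]
  cases k with
  | zero =>
    simp [subdivHomotopy, subdiv]
  | succ k =>
    have h := boundary_subdivHomotopy k (boundary (k + 1) (Finsupp.single v (1 : R)))
    rw [boundary_boundary, map_zero, add_zero] at h
    rw [h]
    abel_nf

/-- Naturality under maps that preserve barycenters. It is used for affine maps, where it makes
subdivision of a simplex compatible with that of its faces. -/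
theorem map_subdiv {f : E → E'} (hf : ∀ k v, f (b k v) = b' k (f ∘ v)) (k : ℕ)
    (x : TupleChain R E k) : map f k (subdiv b k x) = subdiv b' k (map f k x) := by
  suffices h : map (R := R) f k ∘ₗ subdiv b k = subdiv b' k ∘ₗ map f k from
    LinearMap.congr_fun h x
  refine hom_ext fun v => ?_
  cases k with
  | zero => rfl
  | succ k =>
    rw [LinearMap.comp_apply, LinearMap.comp_apply, subdiv_single, map_cone,
      map_subdiv hf k, map_boundary, map_single, subdiv_single, hf]

theorem map_subdivHomotopy {f : E → E'} (hf : ∀ k v, f (b k v) = b' k (f ∘ v)) (k : ℕ)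
    (x : TupleChain R E k) :
    map f (k + 1) (subdivHomotopy b k x) = subdivHomotopy b' k (map f k x) := by
  suffices h : map (R := R) f (k + 1) ∘ₗ subdivHomotopy b k = subdivHomotopy b' k ∘ₗ map f k from
    LinearMap.congr_fun h x
  refine hom_ext fun v => ?_
  cases k with
  | zero => simp [subdivHomotopy]
  | succ k =>
    rw [LinearMap.comp_apply, LinearMap.comp_apply, subdivHomotopy_single, map_cone, map_sub,
      map_subdivHomotopy hf k, map_boundary, map_single, subdivHomotopy_single, hf]

/-- The iterated subdivision operator. -/
noncomputable def iterSubdiv (m k : ℕ) : TupleChain R E k →ₗ[R] TupleChain R E k :=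
  subdiv b k ^ m

/-- The chain homotopy between the identity and the iterated subdivision operator. -/
noncomputable def iterHomotopy (m k : ℕ) : TupleChain R E k →ₗ[R] TupleChain R E (k + 1) :=
  ∑ j ∈ Finset.range m, subdivHomotopy b k ∘ₗ iterSubdiv b j k

theorem iterSubdiv_succ_apply (m k : ℕ) (x : TupleChain R E k) :
    iterSubdiv b (m + 1) k x = subdiv b k (iterSubdiv b m k x) := by
  rw [iterSubdiv, pow_succ', Module.End.mul_apply, iterSubdiv]

theorem boundary_iterSubdiv (m k : ℕ) (x : TupleChain R E (k + 1)) :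
    boundary k (iterSubdiv b m (k + 1) x) = iterSubdiv b m k (boundary k x) := by
  induction m with
  | zero => rfl
  | succ m ih => rw [iterSubdiv_succ_apply, iterSubdiv_succ_apply, boundary_subdiv, ih]

theorem boundary_iterHomotopy (m k : ℕ) (x : TupleChain R E (k + 1)) :
    boundary (k + 1) (iterHomotopy b m (k + 1) x) + iterHomotopy b m k (boundary k x) =
      x - iterSubdiv b m (k + 1) x := by
  simp only [iterHomotopy, LinearMap.sum_apply, LinearMap.comp_apply, map_sum,
    ← boundary_iterSubdiv]
  rw [← Finset.sum_add_distrib]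
  simp only [boundary_subdivHomotopy, ← iterSubdiv_succ_apply]
  rw [Finset.sum_range_sub' (fun j => iterSubdiv b j (k + 1) x)]
  rfl

theorem map_iterSubdiv {f : E → E'} (hf : ∀ k v, f (b k v) = b' k (f ∘ v)) (m k : ℕ)
    (x : TupleChain R E k) : map f k (iterSubdiv b m k x) = iterSubdiv b' m k (map f k x) := by
  induction m with
  | zero => rfl
  | succ m ih => rw [iterSubdiv_succ_apply, iterSubdiv_succ_apply, map_subdiv b b' hf, ih]

theorem map_iterHomotopy {f : E → E'} (hf : ∀ k v, f (b k v) = b' k (f ∘ v)) (m k : ℕ)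
    (x : TupleChain R E k) :
    map f (k + 1) (iterHomotopy b m k x) = iterHomotopy b' m k (map f k x) := by
  simp only [iterHomotopy, LinearMap.sum_apply, LinearMap.comp_apply, map_sum]
  exact Finset.sum_congr rfl fun j _ => by
    rw [map_subdivHomotopy b b' hf, map_iterSubdiv b b' hf]

end subdiv

/-- A linear map sends chains supported in `s` into a submodule as soon as it sends the elements
of `s` there. -/
theorem map_mem_of_supported {α M : Type*} [AddCommGroup M] [Module R M] {s : Set α}
    {p : Submodule R M} (f : (α →₀ R) →ₗ[R] M) (h : ∀ a ∈ s, f (Finsupp.single a 1) ∈ p)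
    {x : α →₀ R} (hx : x ∈ Finsupp.supported R R s) : f x ∈ p := by
  rw [Finsupp.supported_eq_span_single] at hx
  have : Submodule.span R ((fun a => Finsupp.single a (1 : R)) '' s) ≤ p.comap f :=
    Submodule.span_le.2 (Set.image_subset_iff.2 h)
  exact this hx

/-- Tuples with entries in `C` and with pairwise distances at most `δ`. -/
def smallTuples [PseudoMetricSpace E] (C : Set E) (δ : ℝ) (k : ℕ) : Set (Fin k → E) :=
  {v | (∀ i, v i ∈ C) ∧ ∀ i j, dist (v i) (v j) ≤ δ}

end TupleChain

/-! ### Affine simplices in standard simplices -/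

namespace Singular

/-- The affine map from a standard simplex with prescribed images of the vertices. -/
noncomputable def affine {k N : ℕ} (v : Fin (k + 1) → stdSimplex ℝ (Fin (N + 1))) :
    C(stdSimplex ℝ (Fin (k + 1)), stdSimplex ℝ (Fin (N + 1))) where
  toFun t := ⟨∑ i, t.1 i • (v i).1, (convex_stdSimplex ℝ _).sum_mem (fun i _ => t.2.1 i) t.2.2
    fun i _ => (v i).2⟩
  continuous_toFun := by
    refine Continuous.subtype_mk (continuous_finsetSum _ fun i _ => ?_) _
    exact ((continuous_apply i).comp continuous_subtype_val).smul continuous_const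

theorem affine_coe {k N : ℕ} (v : Fin (k + 1) → stdSimplex ℝ (Fin (N + 1)))
    (t : stdSimplex ℝ (Fin (k + 1))) : (affine v t).1 = ∑ i, t.1 i • (v i).1 := rfl

theorem affine_affine {k M N : ℕ} (u : Fin (M + 1) → stdSimplex ℝ (Fin (N + 1)))
    (v : Fin (k + 1) → stdSimplex ℝ (Fin (M + 1))) (t : stdSimplex ℝ (Fin (k + 1))) :
    affine u (affine v t) = affine (affine u ∘ v) t := by
  apply Subtype.ext
  simp only [affine_coe, Function.comp_apply, Finset.sum_apply, Pi.smul_apply, Finset.sum_smul,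
    Finset.smul_sum, smul_eq_mul, mul_smul]
  exact Finset.sum_comm

theorem affine_comp {k M N : ℕ} (u : Fin (M + 1) → stdSimplex ℝ (Fin (N + 1)))
    (v : Fin (k + 1) → stdSimplex ℝ (Fin (M + 1))) :
    (affine u).comp (affine v) = affine (affine u ∘ v) :=
  ContinuousMap.ext fun t => affine_affine u v t

theorem affine_apply_vertex {k N : ℕ} (v : Fin (k + 1) → stdSimplex ℝ (Fin (N + 1)))
    (i : Fin (k + 1)) : affine v (stdSimplex.vertex i) = v i := by
  apply Subtype.ext
  rw [affine_coe, Finset.sum_eq_single i]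
  · simp
  · intro j _ hj
    simp [Pi.single_eq_of_ne hj]
  · simp

theorem affine_vertex (N : ℕ) :
    affine (fun i : Fin (N + 1) => stdSimplex.vertex i) = ContinuousMap.id _ := by
  ext t j
  change (∑ i, t.1 i • (Pi.single i 1 : Fin (N + 1) → ℝ)) j = t.1 j
  simp [Finset.sum_apply, Pi.single_apply]

theorem faceInclusion_eq_affine (n : ℕ) (i : Fin (n + 2)) :
    faceInclusion n i = affine fun j => stdSimplex.vertex (i.succAbove j) := by
  ext t j
  change FunOnFinite.linearMap ℝ ℝ i.succAbove t.1 j =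
    (∑ l, t.1 l • (Pi.single (i.succAbove l) 1 : Fin (n + 2) → ℝ)) j
  rw [FunOnFinite.linearMap_apply_apply, Finset.sum_apply, Finset.sum_filter]
  refine Finset.sum_congr rfl fun l _ => ?_
  simp [Pi.single_apply, eq_comm]

theorem affine_comp_faceInclusion {n N : ℕ} (v : Fin (n + 2) → stdSimplex ℝ (Fin (N + 1)))
    (i : Fin (n + 2)) : (affine v).comp (faceInclusion n i) = affine (v ∘ i.succAbove) := by
  rw [faceInclusion_eq_affine, affine_comp]
  congr 1
  funext j
  exact affine_apply_vertex v _

/-- The barycenter of a tuple of points of a standard simplex. -/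
noncomputable def bary (N k : ℕ) (v : Fin (k + 1) → stdSimplex ℝ (Fin (N + 1))) :
    stdSimplex ℝ (Fin (N + 1)) :=
  affine v stdSimplex.barycenter

theorem affine_bary {k M N : ℕ} (u : Fin (M + 1) → stdSimplex ℝ (Fin (N + 1)))
    (v : Fin (k + 1) → stdSimplex ℝ (Fin (M + 1))) :
    affine u (bary M k v) = bary N k (affine u ∘ v) :=
  affine_affine u v _

theorem affine_mem {k N : ℕ} {C : Set (Fin (N + 1) → ℝ)} (hC : Convex ℝ C)
    {v : Fin (k + 1) → stdSimplex ℝ (Fin (N + 1))} (hv : ∀ i, (v i).1 ∈ C)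
    (t : stdSimplex ℝ (Fin (k + 1))) : (affine v t).1 ∈ C :=
  hC.sum_mem (fun i _ => t.2.1 i) t.2.2 fun i _ => hv i

/-- The vector from the barycenter to `v i` is the average of the `k + 1` differences `v i - v j`,
and the one with `j = i` is zero. -/
theorem dist_bary_le {N k : ℕ} {δ : ℝ} (v : Fin (k + 1) → stdSimplex ℝ (Fin (N + 1)))
    (hv : ∀ i j, dist (v i) (v j) ≤ δ) (i : Fin (k + 1)) :
    dist (v i) (bary N k v) ≤ k / (k + 1) * δ := by
  have hk : (0 : ℝ) < k + 1 := by positivity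
  have h1 : (v i).1 - (bary N k v).1 = ∑ j, ((k : ℝ) + 1)⁻¹ • ((v i).1 - (v j).1) := by
    rw [← Finset.smul_sum, Finset.sum_sub_distrib, smul_sub, Finset.sum_const, Finset.card_univ,
      Fintype.card_fin, ← Nat.cast_smul_eq_nsmul ℝ, smul_smul, Nat.cast_succ,
      inv_mul_cancel₀ hk.ne', one_smul, Finset.smul_sum]
    congr 1
    rw [bary, affine_coe]
    simp
  rw [Subtype.dist_eq, dist_eq_norm, h1,
    ← Finset.add_sum_erase _ _ (Finset.mem_univ i), sub_self, smul_zero, zero_add]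
  calc _ ≤ ∑ j ∈ Finset.univ.erase i, ((k : ℝ) + 1)⁻¹ * δ := by
        refine norm_sum_le_of_le _ fun j _ => ?_
        rw [norm_smul, Real.norm_of_nonneg (by positivity), ← dist_eq_norm, ← Subtype.dist_eq]
        exact mul_le_mul_of_nonneg_left (hv i j) (by positivity)
    _ = k / (k + 1) * δ := by
        rw [Finset.sum_const, Finset.card_erase_of_mem (Finset.mem_univ i), Finset.card_univ,
          Fintype.card_fin, Nat.add_sub_cancel, nsmul_eq_mul]
        ring

variable (R : Type v) [CommRing R]

-- The convex set `C` makes the induction work: the facets are subdivided inside `C` intersected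
-- with a closed ball about the barycenter, so coning off to the barycenter creates no long edge.
-- The dimension bound `d` stays fixed so that all faces share one contraction ratio.
open TupleChain in
theorem subdiv_single_mem {N d : ℕ} {δ : ℝ} (hδ : 0 ≤ δ) (k : ℕ) (hk : k ≤ d + 1)
    (C : Set (Fin (N + 1) → ℝ)) (hC : Convex ℝ C)
    (v : Fin k → stdSimplex ℝ (Fin (N + 1))) (hv : v ∈ smallTuples (Subtype.val ⁻¹' C) δ k) :
    subdiv (bary N) k (Finsupp.single v (1 : R)) ∈ Finsupp.supported R R
      (smallTuples (Subtype.val ⁻¹' C) (d / (d + 1) * δ) k) := by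
  induction k generalizing C with
  | zero => exact Finsupp.single_mem_supported R _ ⟨fun i => i.elim0, fun i => i.elim0⟩
  | succ k ih =>
    set b := bary N k v with hb
    set ρ : ℝ := d / (d + 1) * δ with hρ
    have hkd : (k : ℝ) ≤ d := by exact_mod_cast (by omega : k ≤ d)
    have hρ0 : 0 ≤ ρ := by positivity
    have hle : (k : ℝ) / (k + 1) * δ ≤ ρ := by
      refine mul_le_mul_of_nonneg_right ?_ hδ
      rw [div_le_div_iff₀ (by positivity) (by positivity)]
      nlinarith
    have hbC : b.1 ∈ C := affine_mem hC hv.1 _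
    rw [subdiv_single, boundary_single]
    have key : subdiv (bary N) k (∑ i : Fin (k + 1), (-1 : ℤ) ^ (i : ℕ) •
        Finsupp.single (v ∘ i.succAbove) (1 : R)) ∈ Finsupp.supported R R
          (smallTuples (Subtype.val ⁻¹' (C ∩ Metric.closedBall b.1 ρ)) ρ k) := by
      rw [map_sum]
      refine Submodule.sum_mem _ fun i _ => ?_
      rw [map_zsmul]
      refine zsmul_mem (ih (by omega) _ (hC.inter (convex_closedBall _ _)) _ ⟨fun j => ?_,
        fun j l => hv.2 _ _⟩) _
      exact ⟨hv.1 _, (dist_bary_le v hv.2 _).trans hle⟩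
    refine map_mem_of_supported (cone b k) (fun w hw => ?_) key
    rw [cone_single]
    refine Finsupp.single_mem_supported R _ ⟨fun j => ?_, fun j l => ?_⟩
    · refine Fin.cases ?_ (fun j => ?_) j
      · exact hbC
      · exact (hw.1 j).1
    · refine Fin.cases ?_ (fun j => ?_) j <;> refine Fin.cases ?_ (fun l => ?_) l
      · simpa using hρ0
      · exact (dist_comm _ _).trans_le (hw.1 l).2
      · exact (hw.1 j).2
      · exact hw.2 j l

open TupleChain in
theorem iterSubdiv_single_mem {N k : ℕ} (v : Fin (k + 1) → stdSimplex ℝ (Fin (N + 1))) (m : ℕ) :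
    iterSubdiv (bary N) m (k + 1) (Finsupp.single v (1 : R)) ∈ Finsupp.supported R R
      (smallTuples Set.univ ((k / (k + 1) : ℝ) ^ m) (k + 1)) := by
  induction m with
  | zero =>
    refine Finsupp.single_mem_supported R _ ⟨fun i => trivial, fun i j => ?_⟩
    rw [pow_zero]
    -- The induction starts from the diameter of the standard simplex, which is at most `1`.
    exact (Metric.dist_le_diam_of_mem (bounded_stdSimplex _) (v i).2 (v j).2).trans
      diam_stdSimplex_le
  | succ m ih =>
    rw [iterSubdiv_succ_apply, pow_succ']
    refine map_mem_of_supported _ (fun w hw => ?_) ih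
    simpa using subdiv_single_mem R (by positivity) (k + 1) le_rfl Set.univ convex_univ w
      (by simpa using hw)

end Singular

/-! ### Small singular simplices -/

namespace Singular

section chains

variable (R : Type v) [CommRing R] {X : Type u} [TopologicalSpace X]

/-- Singular chains with coefficients in `R`. -/
abbrev Chain (R : Type v) [CommRing R] (X : Type u) [TopologicalSpace X] (n : ℕ) :
    Type (max u v) :=
  C(stdSimplex ℝ (Fin (n + 1)), X) →₀ R

/-- The boundary of singular chains. -/
noncomputable def chainBoundary (X : Type u) [TopologicalSpace X] (n : ℕ) :
    Chain R X (n + 1) →ₗ[R] Chain R X n :=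
  Finsupp.linearCombination R fun s =>
    ∑ i : Fin (n + 2), (-1 : ℤ) ^ (i : ℕ) • Finsupp.single (s.comp (faceInclusion n i)) (1 : R)

theorem chainBoundary_single (n : ℕ) (s : C(stdSimplex ℝ (Fin (n + 2)), X)) :
    chainBoundary R X n (Finsupp.single s 1) =
      ∑ i : Fin (n + 2), (-1 : ℤ) ^ (i : ℕ) •
        Finsupp.single (s.comp (faceInclusion n i)) (1 : R) := by
  simp [chainBoundary]

/-- The chain map sending a tuple of points of `Δᴺ` to the restriction of `s : Δᴺ → X` to the
affine simplex which they span. -/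
noncomputable def push {N : ℕ} (s : C(stdSimplex ℝ (Fin (N + 1)), X)) (k : ℕ) :
    TupleChain R (stdSimplex ℝ (Fin (N + 1))) (k + 1) →ₗ[R] Chain R X k :=
  Finsupp.lmapDomain R R fun v => s.comp (affine v)

@[simp]
theorem push_single {N : ℕ} (s : C(stdSimplex ℝ (Fin (N + 1)), X)) (k : ℕ)
    (v : Fin (k + 1) → stdSimplex ℝ (Fin (N + 1))) (r : R) :
    push R s k (Finsupp.single v r) = Finsupp.single (s.comp (affine v)) r := by
  simp [push]

theorem chainBoundary_push {N : ℕ} (s : C(stdSimplex ℝ (Fin (N + 1)), X)) (k : ℕ)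
    (x : TupleChain R (stdSimplex ℝ (Fin (N + 1))) (k + 2)) :
    chainBoundary R X k (push R s (k + 1) x) = push R s k (TupleChain.boundary (k + 1) x) := by
  suffices h : chainBoundary R X k ∘ₗ push R s (k + 1) =
    push R s k ∘ₗ TupleChain.boundary (k + 1) from LinearMap.congr_fun h x
  refine TupleChain.hom_ext fun v => ?_
  simp [chainBoundary_single, TupleChain.boundary_single, ContinuousMap.comp_assoc,
    affine_comp_faceInclusion]

theorem push_comp_affine {M N : ℕ} (s : C(stdSimplex ℝ (Fin (N + 1)), X))
    (u : Fin (M + 1) → stdSimplex ℝ (Fin (N + 1))) (k : ℕ)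
    (x : TupleChain R (stdSimplex ℝ (Fin (M + 1))) (k + 1)) :
    push R (s.comp (affine u)) k x = push R s k (TupleChain.map (affine u) (k + 1) x) := by
  suffices h : push R (s.comp (affine u)) k = push R s k ∘ₗ TupleChain.map (affine u) (k + 1) from
    LinearMap.congr_fun h x
  refine TupleChain.hom_ext fun v => ?_
  simp [ContinuousMap.comp_assoc, affine_comp]

/-- The tuple of vertices of the standard simplex. -/
noncomputable abbrev vertices (n : ℕ) : Fin (n + 1) → stdSimplex ℝ (Fin (n + 1)) :=
  fun i => stdSimplex.vertex i

/-- The `m`-fold barycentric subdivision of singular chains. -/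
noncomputable def sd (X : Type u) [TopologicalSpace X] (m n : ℕ) : Chain R X n →ₗ[R] Chain R X n :=
  Finsupp.linearCombination R fun s =>
    push R s n (TupleChain.iterSubdiv (bary n) m (n + 1) (Finsupp.single (vertices n) 1))

/-- The chain homotopy between the identity and the `m`-fold barycentric subdivision. -/
noncomputable def sdHomotopy (X : Type u) [TopologicalSpace X] (m n : ℕ) :
    Chain R X n →ₗ[R] Chain R X (n + 1) :=
  Finsupp.linearCombination R fun s =>
    push R s (n + 1) (TupleChain.iterHomotopy (bary n) m (n + 1) (Finsupp.single (vertices n) 1))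

theorem sd_single (m n : ℕ) (s : C(stdSimplex ℝ (Fin (n + 1)), X)) :
    sd R X m n (Finsupp.single s 1) =
      push R s n (TupleChain.iterSubdiv (bary n) m (n + 1) (Finsupp.single (vertices n) 1)) := by
  simp [sd]

theorem sdHomotopy_single (m n : ℕ) (s : C(stdSimplex ℝ (Fin (n + 1)), X)) :
    sdHomotopy R X m n (Finsupp.single s 1) = push R s (n + 1)
      (TupleChain.iterHomotopy (bary n) m (n + 1) (Finsupp.single (vertices n) 1)) := by
  simp [sdHomotopy]

/-- The homotopy of a face can be computed inside the ambient simplex, because affine maps preserve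
barycenters. This reduces the homotopy formula for singular chains to the one for tuples. -/
theorem sdHomotopy_face (m n : ℕ) (s : C(stdSimplex ℝ (Fin (n + 2)), X)) (i : Fin (n + 2)) :
    sdHomotopy R X m n (Finsupp.single (s.comp (faceInclusion n i)) 1) = push R s (n + 1)
      (TupleChain.iterHomotopy (bary (n + 1)) m (n + 1)
        (Finsupp.single (vertices (n + 1) ∘ i.succAbove) 1)) := by
  rw [sdHomotopy_single, faceInclusion_eq_affine, push_comp_affine,
    TupleChain.map_iterHomotopy (bary n) (bary (n + 1)) (fun _ v => affine_bary _ v),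
    TupleChain.map_single]
  congr 3
  funext j
  exact affine_apply_vertex _ j

theorem chainBoundary_sdHomotopy (m n : ℕ) (x : Chain R X (n + 1)) :
    chainBoundary R X (n + 1) (sdHomotopy R X m (n + 1) x) +
      sdHomotopy R X m n (chainBoundary R X n x) = x - sd R X m (n + 1) x := by
  suffices h : chainBoundary R X (n + 1) ∘ₗ sdHomotopy R X m (n + 1) +
      sdHomotopy R X m n ∘ₗ chainBoundary R X n = LinearMap.id - sd R X m (n + 1) from
    LinearMap.congr_fun h x
  refine TupleChain.hom_ext fun s => ?_
  have h := congrArg (push R s (n + 1)) (TupleChain.boundary_iterHomotopy (bary (n + 1)) m (n + 1)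
    (Finsupp.single (vertices (n + 1)) (1 : R)))
  rw [map_add, map_sub, ← chainBoundary_push, ← sdHomotopy_single, ← sd_single, push_single,
    affine_vertex, ContinuousMap.comp_id, TupleChain.boundary_single] at h
  rw [LinearMap.add_apply, LinearMap.comp_apply, LinearMap.comp_apply, LinearMap.sub_apply,
    LinearMap.id_apply, ← h, chainBoundary_single]
  simp only [map_sum, map_zsmul, sdHomotopy_face]

variable {ι : Type w} (U : ι → Set X)

/-- The singular simplices contained in a member of the cover. -/
def smallSimplices (n : ℕ) : Set C(stdSimplex ℝ (Fin (n + 1)), X) :=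
  {s | ∃ i, ∀ t, s t ∈ U i}

theorem push_mem_small {N : ℕ} {s : C(stdSimplex ℝ (Fin (N + 1)), X)}
    (hs : s ∈ smallSimplices U N) (k : ℕ) (x : TupleChain R (stdSimplex ℝ (Fin (N + 1))) (k + 1)) :
    push R s k x ∈ Finsupp.supported R R (smallSimplices U k) := by
  obtain ⟨i, hi⟩ := hs
  refine TupleChain.map_mem_of_supported (s := Set.univ) _ (fun v _ => ?_)
    (by simp [Finsupp.supported_univ])
  rw [push_single]
  exact Finsupp.single_mem_supported R _ ⟨i, fun t => hi _⟩

theorem sdHomotopy_mem_small {m n : ℕ} {x : Chain R X n}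
    (hx : x ∈ Finsupp.supported R R (smallSimplices U n)) :
    sdHomotopy R X m n x ∈ Finsupp.supported R R (smallSimplices U (n + 1)) :=
  TupleChain.map_mem_of_supported _ (fun s hs => by
    rw [sdHomotopy_single]; exact push_mem_small R U hs _ _) hx

variable {U}

/-- Sufficiently fine subdivisions of a singular simplex are small. -/
theorem eventually_sd_single_mem_small (hopen : ∀ i, IsOpen (U i)) (hcover : ⋃ i, U i = Set.univ)
    (n : ℕ) (s : C(stdSimplex ℝ (Fin (n + 1)), X)) :
    ∀ᶠ m in Filter.atTop, sd R X m n (Finsupp.single s 1) ∈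
      Finsupp.supported R R (smallSimplices U n) := by
  -- `δ` is a Lebesgue number of the cover pulled back to the compact simplex.
  obtain ⟨δ, hδ, hball⟩ := lebesgue_number_lemma_of_metric (c := fun i => s ⁻¹' U i)
    (isCompact_univ (X := stdSimplex ℝ (Fin (n + 1)))) (fun i => (hopen i).preimage s.continuous)
    (by rw [← Set.preimage_iUnion, hcover, Set.preimage_univ])
  have hlim : Filter.Tendsto (fun m : ℕ => (n / (n + 1) : ℝ) ^ m) Filter.atTop (nhds 0) :=
    tendsto_pow_atTop_nhds_zero_of_lt_one (by positivity)
      ((div_lt_one (by positivity)).2 (lt_add_one _))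
  filter_upwards [hlim.eventually_lt_const hδ] with m hm
  rw [sd_single]
  refine TupleChain.map_mem_of_supported _ (fun v hv => ?_) (iterSubdiv_single_mem R (vertices n) m)
  rw [push_single]
  -- All vertices of a piece lie in the `δ`-ball about its vertex `v 0`. By convexity the whole
  -- piece does, and this ball maps into a single `U i`.
  obtain ⟨i, hi⟩ := hball (v 0) (Set.mem_univ _)
  refine Finsupp.single_mem_supported R _ ⟨i, fun t => hi ?_⟩
  exact affine_mem (convex_ball (v 0).1 δ) (fun j => (hv.2 j 0).trans_lt hm) t

theorem eventually_sd_mem_small (hopen : ∀ i, IsOpen (U i)) (hcover : ⋃ i, U i = Set.univ)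
    (n : ℕ) (x : Chain R X n) :
    ∀ᶠ m in Filter.atTop, sd R X m n x ∈ Finsupp.supported R R (smallSimplices U n) := by
  induction x using Finsupp.induction_linear with
  | zero => simp
  | add x y hx hy =>
    filter_upwards [hx, hy] with m h1 h2
    rw [map_add]
    exact add_mem h1 h2
  | single s r =>
    filter_upwards [eventually_sd_single_mem_small R hopen hcover n s] with m h
    rw [← mul_one r, ← smul_eq_mul, ← Finsupp.smul_single, map_smul]
    exact Submodule.smul_mem _ _ h

end chains

/-! ### Acyclicity of the cochains vanishing on small simplices -/

section cochains

variable {R : Type v} [Field R] {X : Type u} [TopologicalSpace X] {ι : Type w} {U : ι → Set X}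

theorem linearCombination_coboundary (n : ℕ) (c : Cochain R X n) (x : Chain R X (n + 1)) :
    Finsupp.linearCombination R (coboundary R X n c) x =
      Finsupp.linearCombination R c (chainBoundary R X n x) := by
  suffices h : Finsupp.linearCombination R (coboundary R X n c) =
      Finsupp.linearCombination R c ∘ₗ chainBoundary R X n from LinearMap.congr_fun h x
  refine TupleChain.hom_ext fun s => ?_
  simp [chainBoundary_single, coboundary]

theorem linearCombination_eq_zero_of_small {n : ℕ} {c : Cochain R X n}
    (hc : ∀ s ∈ smallSimplices U n, c s = 0) {x : Chain R X n}
    (hx : x ∈ Finsupp.supported R R (smallSimplices U n)) :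
    Finsupp.linearCombination R c x = 0 := by
  refine TupleChain.map_mem_of_supported (p := (⊥ : Submodule R R)) _ (fun s hs => ?_) hx
  simp [hc s hs]

/-- The complex of cochains vanishing on small simplices is acyclic. -/
theorem exists_coboundary_eq_of_small (hopen : ∀ i, IsOpen (U i)) (hcover : ⋃ i, U i = Set.univ)
    (n : ℕ) (c : Cochain R X (n + 1)) (hc : ∀ s ∈ smallSimplices U (n + 1), c s = 0)
    (hdc : coboundary R X (n + 1) c = 0) :
    ∃ e : Cochain R X n, (∀ s ∈ smallSimplices U n, e s = 0) ∧ coboundary R X n e = c := by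
  set S := Finsupp.supported R R (smallSimplices U n) with hS
  set f : Chain R X (n + 1) →ₗ[R] (Chain R X n ⧸ S) := S.mkQ ∘ₗ chainBoundary R X n with hf
  -- As a functional on chains, `c` kills every `x` with small boundary: x = ∂Hx + H∂x + sd x. It is
  -- zero on the first term as a cocycle, and on the other two because they are small once `m` is
  -- large.
  have hmem : Finsupp.linearCombination R c ∈ (LinearMap.ker f).dualAnnihilator := by
    rw [Submodule.mem_dualAnnihilator]
    intro x hx
    have hx' : chainBoundary R X n x ∈ S := by
      rw [LinearMap.mem_ker, hf, LinearMap.comp_apply] at hx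
      exact (Submodule.Quotient.mk_eq_zero S).1 hx
    obtain ⟨m, hm⟩ := (eventually_sd_mem_small R hopen hcover (n + 1) x).exists
    have h := chainBoundary_sdHomotopy R m n x
    rw [eq_sub_iff_add_eq] at h
    rw [← h, map_add, map_add, ← linearCombination_coboundary, hdc,
      linearCombination_eq_zero_of_small hc hm,
      linearCombination_eq_zero_of_small hc (sdHomotopy_mem_small R U hx')]
    simp
  -- Over a field, a functional vanishing on `ker f` factors through `f`. The factor `g`, defined
  -- modulo small chains, is the required cochain.
  rw [← LinearMap.range_dualMap_eq_dualAnnihilator_ker] at hmem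
  obtain ⟨g, hg⟩ := hmem
  refine ⟨fun s => g (S.mkQ (Finsupp.single s 1)), fun s hs => ?_, ?_⟩
  · have : S.mkQ (Finsupp.single s (1 : R)) = 0 :=
      (Submodule.Quotient.mk_eq_zero S).2 (Finsupp.single_mem_supported R _ hs)
    exact (congrArg g this).trans g.map_zero
  · funext s
    have h := LinearMap.congr_fun hg (Finsupp.single s 1)
    rw [LinearMap.dualMap_apply, hf, LinearMap.comp_apply, chainBoundary_single,
      Finsupp.linearCombination_single, one_smul] at h
    rw [← h]
    simp only [map_sum, map_zsmul]
    rfl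

theorem mem_smallSimplices_zero (hcover : ⋃ i, U i = Set.univ)
    (s : C(stdSimplex ℝ (Fin 1), X)) : s ∈ smallSimplices U 0 := by
  obtain ⟨i, hi⟩ := Set.mem_iUnion.1 (hcover.symm ▸ Set.mem_univ (s default))
  exact ⟨i, fun t => by rwa [Subsingleton.elim t default]⟩

end cochains

end Singular

/-! ### The Čech complex of singular cochains for a cover with one-dimensional nerve -/

namespace Cech

open CellularSheaf

variable {R : Type v} [Field R] {X : Type u} [TopologicalSpace X] {ι : Type w} {U : ι → Set X}

/-- Families of singular `n`-cochains on the supports of the `k`-simplices of the nerve. -/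
abbrev Cochain (R : Type v) [Field R] {X : Type u} [TopologicalSpace X] {ι : Type w}
    (U : ι → Set X) (k n : ℕ) :=
  ∀ σ : Simplex (coverNerve U) k, Singular.Cochain R (coverSupport U σ.1.1) n

/-- The singular coboundary, applied to each member of a family. -/
noncomputable def vertical (R : Type v) [Field R] (U : ι → Set X) (k n : ℕ) :
    Cochain R U k n →ₗ[R] Cochain R U k (n + 1) :=
  LinearMap.pi fun σ => Singular.coboundary R (coverSupport U σ.1.1) n ∘ₗ LinearMap.proj σ

/-- The restriction of singular cochains from the support of a face. -/
def restrict (R : Type v) [Field R] (U : ι → Set X) (n : ℕ) {σ τ : Finset ι} (h : σ ⊆ τ) :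
    Singular.Cochain R (coverSupport U σ) n →ₗ[R] Singular.Cochain R (coverSupport U τ) n :=
  Singular.pullback R (ContinuousMap.inclusion (coverSupport_anti U h)) n

/-- The Čech differential. -/
noncomputable def horizontal (R : Type v) [Field R] [LinearOrder ι] (U : ι → Set X) (k n : ℕ) :
    Cochain R U k n →ₗ[R] Cochain R U (k + 1) n :=
  LinearMap.pi fun τ => ∑ i : τ.1.1,
    incidence τ i • (restrict R U n (facet_le τ i) ∘ₗ LinearMap.proj (facet τ i))

/-- The inclusion of a subspace. -/
def inclusion (A : Set X) : C(A, X) := ⟨Subtype.val, continuous_subtype_val⟩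

/-- The restriction of singular cochains of `X` to the members of the cover. -/
def augmentation (R : Type v) [Field R] (U : ι → Set X) (n : ℕ) :
    Singular.Cochain R X n →ₗ[R] Cochain R U 0 n :=
  LinearMap.pi fun σ =>
    Singular.pullback R (inclusion (coverSupport U σ.1.1)) n

theorem horizontal_apply [LinearOrder ι] (k n : ℕ) (a : Cochain R U k n)
    (τ : Simplex (coverNerve U) (k + 1)) :
    horizontal R U k n a τ =
      ∑ i : τ.1.1, incidence τ i • restrict R U n (facet_le τ i) (a (facet τ i)) := by
  simp [horizontal]

theorem vertical_horizontal [LinearOrder ι] (k n : ℕ) (a : Cochain R U k n) :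
    vertical R U (k + 1) n (horizontal R U k n a) =
      horizontal R U k (n + 1) (vertical R U k n a) := by
  funext τ
  rw [horizontal_apply]
  change Singular.coboundary R _ n (horizontal R U k n a τ) = _
  rw [horizontal_apply, map_sum]
  simp only [map_zsmul]
  rfl

theorem vertical_augmentation (n : ℕ) (c : Singular.Cochain R X n) :
    vertical R U 0 n (augmentation R U n c) =
      augmentation R U (n + 1) (Singular.coboundary R X n c) := rfl

/-- A singular simplex with image in `A`, as a singular simplex of `A`. -/
def corestrict {n : ℕ} {A : Set X} (s : C(stdSimplex ℝ (Fin (n + 1)), X)) (h : ∀ t, s t ∈ A) :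
    C(stdSimplex ℝ (Fin (n + 1)), A) :=
  ⟨fun t => ⟨s t, h t⟩, s.continuous.subtype_mk h⟩

section order

variable [LinearOrder ι]

/-- Here `σ₀` is the smaller and `σ₁` the larger endpoint of `τ`: deleting the smaller vertex has
sign `+1` and leaves the larger one. -/
theorem horizontal_zero_apply (τ : Simplex (coverNerve U) 1) :
    ∃ (σ₀ σ₁ : Simplex (coverNerve U) 0) (h₀ : σ₀.1.1 ⊆ τ.1.1) (h₁ : σ₁.1.1 ⊆ τ.1.1), σ₀ ≠ σ₁ ∧
      (∀ σ : Simplex (coverNerve U) 0, σ.1.1 ⊆ τ.1.1 → σ = σ₀ ∨ σ = σ₁) ∧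
      ∀ n (a : Cochain R U 0 n), horizontal R U 0 n a τ =
        restrict R U n h₁ (a σ₁) - restrict R U n h₀ (a σ₀) := by
  obtain ⟨i, j, hij, hτ⟩ : ∃ i j, i < j ∧ τ.1.1 = {i, j} := by
    obtain ⟨i, j, hne, h⟩ := Finset.card_eq_two.1 τ.2
    rcases hne.lt_or_gt with hlt | hlt
    · exact ⟨i, j, hlt, h⟩
    · exact ⟨j, i, hlt, h.trans (Finset.pair_comm i j)⟩
  have hi : i ∈ τ.1.1 := by simp [hτ]
  have hj : j ∈ τ.1.1 := by simp [hτ]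
  have ei : τ.1.1.erase i = {j} := by rw [hτ]; ext x; simp; grind
  have ej : τ.1.1.erase j = {i} := by rw [hτ]; ext x; simp; grind
  refine ⟨facet τ ⟨j, hj⟩, facet τ ⟨i, hi⟩, facet_le τ _, facet_le τ _, fun h => ?_,
    fun σ hσ => ?_, fun n a => ?_⟩
  · have h' : τ.1.1.erase j = τ.1.1.erase i := congrArg (fun σ => σ.1.1) h
    rw [ei, ej, Finset.singleton_inj] at h'
    exact hij.ne h'
  · obtain ⟨l, hl⟩ := Finset.card_eq_one.1 σ.2
    have hlτ : l ∈ τ.1.1 := hσ (by simp [hl])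
    rw [hτ, Finset.mem_insert, Finset.mem_singleton] at hlτ
    rcases hlτ with rfl | rfl
    · exact Or.inl (Subtype.ext (Subtype.ext (hl.trans ej.symm)))
    · exact Or.inr (Subtype.ext (Subtype.ext (hl.trans ei.symm)))
  · have huniv : (Finset.univ : Finset τ.1.1) = {⟨i, hi⟩, ⟨j, hj⟩} := by
      ext ⟨x, hx⟩
      have hx' := hx
      rw [hτ] at hx'
      simpa using hx'
    have inci : incidence τ ⟨i, hi⟩ = 1 := by
      have : τ.1.1.filter (· < i) = ∅ := by rw [hτ]; ext x; simp; grind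
      rw [incidence, this, Finset.card_empty, pow_zero]
    have incj : incidence τ ⟨j, hj⟩ = -1 := by
      have : τ.1.1.filter (· < j) = {i} := by rw [hτ]; ext x; simp; grind
      rw [incidence, this, Finset.card_singleton, pow_one]
    rw [horizontal_apply, huniv, Finset.sum_pair (fun h => hij.ne (congrArg Subtype.val h)),
      inci, incj, one_smul, neg_one_smul, sub_eq_add_neg]

/-- Two simplices of the nerve whose supports meet span a simplex. -/
theorem union_mem_faces {X : Type u} {U : ι → Set X} {σ τ : (coverNerve U).faces} {x : X} (hσ : x ∈ coverSupport U σ.1)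
    (hτ : x ∈ coverSupport U τ.1) : σ.1 ∪ τ.1 ∈ (coverNerve U).faces := by
  refine ⟨σ.2.1.mono Finset.subset_union_left, x, ?_⟩
  simp only [coverSupport, Set.mem_iInter] at hσ hτ ⊢
  intro i hi
  rcases Finset.mem_union.1 hi with h | h
  exacts [hσ i h, hτ i h]

/-- Distinct edges have disjoint supports: at a common point their union would be a simplex with
more than two vertices. -/
theorem edge_unique {X : Type u} {U : ι → Set X} (hdim : ∀ σ ∈ (coverNerve U).faces, σ.card ≤ 2)
    {σ τ : Simplex (coverNerve U) 1} {x : X} (hσ : x ∈ coverSupport U σ.1.1)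
    (hτ : x ∈ coverSupport U τ.1.1) : σ = τ := by
  have h := hdim _ (union_mem_faces hσ hτ)
  have h1 : σ.1.1 = σ.1.1 ∪ τ.1.1 :=
    Finset.eq_of_subset_of_card_le Finset.subset_union_left (h.trans_eq σ.2.symm)
  have h2 : τ.1.1 = σ.1.1 ∪ τ.1.1 :=
    Finset.eq_of_subset_of_card_le Finset.subset_union_right (h.trans_eq τ.2.symm)
  exact Subtype.ext (Subtype.ext (h1.trans h2.symm))

theorem exists_edge {X : Type u} {U : ι → Set X} (hdim : ∀ σ ∈ (coverNerve U).faces, σ.card ≤ 2)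
    {σ τ : Simplex (coverNerve U) 0} (hne : σ ≠ τ) {x : X} (hσ : x ∈ coverSupport U σ.1.1)
    (hτ : x ∈ coverSupport U τ.1.1) :
    ∃ ρ : Simplex (coverNerve U) 1, σ.1.1 ⊆ ρ.1.1 ∧ τ.1.1 ⊆ ρ.1.1 ∧
      coverSupport U σ.1.1 ∩ coverSupport U τ.1.1 ⊆ coverSupport U ρ.1.1 := by
  have hmem := union_mem_faces hσ hτ
  have hcard : (σ.1.1 ∪ τ.1.1).card = 1 + 1 := by
    refine le_antisymm (hdim _ hmem) (Nat.lt_of_not_le fun hle => hne ?_)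
    have h1 : σ.1.1 = σ.1.1 ∪ τ.1.1 :=
      Finset.eq_of_subset_of_card_le Finset.subset_union_left (hle.trans_eq σ.2.symm)
    have h2 : τ.1.1 = σ.1.1 ∪ τ.1.1 :=
      Finset.eq_of_subset_of_card_le Finset.subset_union_right (hle.trans_eq τ.2.symm)
    exact Subtype.ext (Subtype.ext (h1.trans h2.symm))
  refine ⟨⟨⟨_, hmem⟩, hcard⟩, Finset.subset_union_left, Finset.subset_union_right, ?_⟩
  rintro y ⟨h1, h2⟩
  simp only [coverSupport, Set.mem_iInter] at h1 h2 ⊢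
  intro i hi
  rcases Finset.mem_union.1 hi with h | h
  exacts [h1 i h, h2 i h]

/-- Assign each edge cochain to the larger endpoint and extend it by zero to simplices lying in no
edge support. A singular simplex lies in at most one edge support, so the choices do not interfere.
-/
theorem horizontal_surjective (hdim : ∀ σ ∈ (coverNerve U).faces, σ.card ≤ 2) (n : ℕ) :
    Function.Surjective (horizontal R U 0 n) := by
  classical
  intro (b : Cochain R U 1 n)
  choose σ₀ σ₁ h₀ h₁ hne _ hδ using fun τ => horizontal_zero_apply (R := R) (U := U) τ
  let P (σ : Simplex (coverNerve U) 0) (s : C(stdSimplex ℝ (Fin (n + 1)), X))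
    (τ : Simplex (coverNerve U) 1) : Prop := σ = σ₁ τ ∧ ∀ t, s t ∈ coverSupport U τ.1.1
  let a' : Simplex (coverNerve U) 0 → C(stdSimplex ℝ (Fin (n + 1)), X) → R := fun σ s =>
    if h : ∃ τ, P σ s τ then b h.choose (corestrict s h.choose_spec.2) else 0
  refine ⟨fun σ s => a' σ ((inclusion _).comp s), funext fun τ => ?_⟩
  rw [hδ]
  let t₀ : stdSimplex ℝ (Fin (n + 1)) := Classical.arbitrary _
  have e1 : ∀ (s : C(stdSimplex ℝ (Fin (n + 1)), X)) (hs : ∀ t, s t ∈ coverSupport U τ.1.1), a' (σ₁ τ) s = b τ (corestrict s hs) := by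
    intro s hs
    have h : ∃ τ', P (σ₁ τ) s τ' := ⟨τ, rfl, hs⟩
    refine (dif_pos h).trans ?_
    have key : ∀ (τ' : Simplex (coverNerve U) 1) (h' : ∀ t, s t ∈ coverSupport U τ'.1.1), τ' = τ →
        b τ' (corestrict s h') = b τ (corestrict s hs) := by
      rintro _ _ rfl
      rfl
    exact key _ h.choose_spec.2 (edge_unique hdim (h.choose_spec.2 t₀) (hs t₀))
  have e0 : ∀ (s : C(stdSimplex ℝ (Fin (n + 1)), X)) (hs : ∀ t, s t ∈ coverSupport U τ.1.1), a' (σ₀ τ) s = 0 := by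
    intro s hs
    refine dif_neg ?_
    rintro ⟨τ', hτ', h'⟩
    obtain rfl : τ' = τ := edge_unique hdim (h' t₀) (hs t₀)
    exact hne _ hτ'
  funext s
  have hs : ∀ t, (inclusion _).comp s t ∈ coverSupport U τ.1.1 := fun t => (s t).2
  exact (congrArg₂ (· - ·) (e1 _ hs) (e0 _ hs)).trans (sub_zero _)

/-- A simplex contained in two supports lies in the support of the edge joining them, where the
values of `a` agree. Hence they define a cochain on small simplices, extended by zero to the others.
-/
theorem exists_augmentation_eq (hdim : ∀ σ ∈ (coverNerve U).faces, σ.card ≤ 2) (n : ℕ)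
    (a : Cochain R U 0 n) (ha : horizontal R U 0 n a = 0) : ∃ c, augmentation R U n c = a := by
  classical
  have key : ∀ (s : C(stdSimplex ℝ (Fin (n + 1)), X)) (σ τ : Simplex (coverNerve U) 0)
      (hσ : ∀ t, s t ∈ coverSupport U σ.1.1) (hτ : ∀ t, s t ∈ coverSupport U τ.1.1),
      a σ (corestrict s hσ) = a τ (corestrict s hτ) := by
    intro s σ τ hσ hτ
    by_cases hne : σ = τ
    · subst hne; rfl
    let t₀ : stdSimplex ℝ (Fin (n + 1)) := Classical.arbitrary _
    obtain ⟨ρ, hσρ, hτρ, hsub⟩ := exists_edge hdim hne (hσ t₀) (hτ t₀)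
    have hρ : ∀ t, s t ∈ coverSupport U ρ.1.1 := fun t => hsub ⟨hσ t, hτ t⟩
    obtain ⟨σ₀, σ₁, h₀, h₁, -, hall, hδ⟩ := horizontal_zero_apply (R := R) (U := U) ρ
    have h := congrFun (hδ n a) (corestrict s hρ)
    rw [ha, Pi.sub_apply] at h
    have h' : a σ₁ (corestrict s fun t => coverSupport_anti U h₁ (hρ t)) =
        a σ₀ (corestrict s fun t => coverSupport_anti U h₀ (hρ t)) := sub_eq_zero.1 h.symm
    rcases hall σ hσρ with rfl | rfl <;> rcases hall τ hτρ with rfl | rfl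
    exacts [rfl, h'.symm, h', rfl]
  refine ⟨fun s => if h : ∃ σ : Simplex (coverNerve U) 0, ∀ t, s t ∈ coverSupport U σ.1.1 then
    a h.choose (corestrict s h.choose_spec) else 0, ?_⟩
  funext σ s
  have h : ∃ τ : Simplex (coverNerve U) 0, ∀ t, (s t).1 ∈ coverSupport U τ.1.1 :=
    ⟨σ, fun t => (s t).2⟩
  refine (dif_pos h).trans ?_
  exact key ((inclusion (coverSupport U σ.1.1)).comp s) _ σ h.choose_spec
    fun t => (s t).2

theorem horizontal_augmentation (n : ℕ) (c : Singular.Cochain R X n) :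
    horizontal R U 0 n (augmentation R U n c) = 0 := by
  funext τ
  obtain ⟨σ₀, σ₁, h₀, h₁, -, -, hδ⟩ := horizontal_zero_apply (R := R) (U := U) τ
  rw [hδ]
  exact sub_self _

end order

/-- Vertices of the nerve are the singletons `{i}` with `U i` non-empty, and a `U i` containing a
singular simplex is non-empty. -/
theorem augmentation_eq_zero_iff (n : ℕ) (c : Singular.Cochain R X n) :
    augmentation R U n c = 0 ↔ ∀ s ∈ Singular.smallSimplices U n, c s = 0 := by
  constructor
  · rintro h s ⟨i, hi⟩
    have hsupp : ∀ t, s t ∈ coverSupport U {i} := fun t => by simpa [coverSupport] using hi t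
    have hface : {i} ∈ (coverNerve U).faces :=
      ⟨Finset.singleton_nonempty i, _, hsupp (Classical.arbitrary _)⟩
    exact congrFun (congrFun h ⟨⟨{i}, hface⟩, Finset.card_singleton i⟩) (corestrict s hsupp)
  · intro h
    funext σ s
    obtain ⟨i, hi⟩ := σ.1.2.1
    exact h _ ⟨i, fun t => Set.mem_iInter₂.1 (s t).2 i hi⟩

theorem exists_coboundary_eq (hopen : ∀ i, IsOpen (U i)) (hcover : ⋃ i, U i = Set.univ)
    (n : ℕ) (c : Singular.Cochain R X (n + 1)) (hc : augmentation R U (n + 1) c = 0)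
    (hdc : Singular.coboundary R X (n + 1) c = 0) :
    ∃ e : Singular.Cochain R X n, augmentation R U n e = 0 ∧ Singular.coboundary R X n e = c := by
  obtain ⟨e, he, hde⟩ := Singular.exists_coboundary_eq_of_small hopen hcover n c
    ((augmentation_eq_zero_iff _ _).1 hc) hdc
  exact ⟨e, (augmentation_eq_zero_iff _ _).2 he, hde⟩

theorem augmentation_zero_injective (hcover : ⋃ i, U i = Set.univ) (c : Singular.Cochain R X 0)
    (hc : augmentation R U 0 c = 0) : c = 0 :=
  funext fun s => (augmentation_eq_zero_iff _ _).1 hc s (Singular.mem_smallSimplices_zero hcover s)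

end Cech

/-! ### The singular coboundary squares to zero -/

namespace Singular

/-- Every singular simplex is the push-forward of the tuple of vertices, so the identity is
inherited from tuple chains. -/
theorem chainBoundary_chainBoundary (R : Type v) [CommRing R] {X : Type u} [TopologicalSpace X]
    (n : ℕ) (x : Chain R X (n + 2)) : chainBoundary R X n (chainBoundary R X (n + 1) x) = 0 := by
  suffices h : chainBoundary R X n ∘ₗ chainBoundary R X (n + 1) = 0 from LinearMap.congr_fun h x
  refine TupleChain.hom_ext fun s => ?_
  have h := push_single R s (n + 2) (vertices (n + 2)) 1
  rw [affine_vertex, ContinuousMap.comp_id] at h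
  rw [LinearMap.comp_apply, ← h, chainBoundary_push, chainBoundary_push,
    TupleChain.boundary_boundary, map_zero, LinearMap.zero_apply]

theorem coboundary_coboundary (R : Type v) [Field R] {X : Type u} [TopologicalSpace X] (n : ℕ)
    (c : Cochain R X n) : coboundary R X (n + 1) (coboundary R X n c) = 0 := by
  funext s
  have h := linearCombination_coboundary (n + 1) (coboundary R X n c) (Finsupp.single s 1)
  rw [linearCombination_coboundary n c, chainBoundary_chainBoundary, map_zero,
    Finsupp.linearCombination_single, one_smul] at h
  exact h

end Singular

/-! ### Image and kernel of the restriction to the vertices of the nerve -/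

namespace Cech

open CellularSheaf

variable {R : Type v} [Field R] {X : Type u} [TopologicalSpace X] {ι : Type w} {U : ι → Set X}

/-- The cochain of the Čech cellular sheaf given by the classes of a family of cocycles. -/
noncomputable def classes (R : Type v) [Field R] (U : ι → Set X) (k n : ℕ) :
    LinearMap.ker (vertical R U k n) →ₗ[R] CellularSheaf.Cochain (cechSheaf R U n) k where
  toFun a σ := (Submodule.Quotient.mk ⟨a.1 σ, congrFun (LinearMap.mem_ker.1 a.2) σ⟩ :
    Singular.Cohomology R (coverSupport U σ.1.1) n)
  map_add' _ _ := rfl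
  map_smul' _ _ := rfl

theorem classes_surjective (k n : ℕ) : Function.Surjective (classes R U k n) := by
  intro z
  have h : ∀ σ : Simplex (coverNerve U) k, ∃ a : LinearMap.ker (Singular.coboundary R (coverSupport U σ.1.1) n),
      (Submodule.Quotient.mk a : Singular.Cohomology R (coverSupport U σ.1.1) n) = z σ :=
    fun σ => Submodule.Quotient.mk_surjective _ _
  choose a ha using h
  exact ⟨⟨fun σ => (a σ).1, LinearMap.mem_ker.2 (funext fun σ => (a σ).2)⟩, funext ha⟩

theorem classes_eq_zero_iff (k n : ℕ) (a : LinearMap.ker (vertical R U k n)) :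
    classes R U k n a = 0 ↔ ∀ σ, a.1 σ ∈ CochainSeq.coboundaries
      (Singular.coboundary R (coverSupport U σ.1.1)) n := by
  refine funext_iff.trans (forall_congr' fun σ => ?_)
  exact Submodule.Quotient.mk_eq_zero _

theorem classes_zero_eq_zero_iff (k : ℕ) (a : LinearMap.ker (vertical R U k 0)) :
    classes R U k 0 a = 0 ↔ a.1 = 0 := by
  rw [classes_eq_zero_iff, funext_iff]
  rfl

theorem classes_succ_eq_zero_iff (k n : ℕ) (a : LinearMap.ker (vertical R U k (n + 1))) :
    classes R U k (n + 1) a = 0 ↔ ∃ b, vertical R U k n b = a.1 := by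
  rw [classes_eq_zero_iff]
  constructor
  · intro h
    choose b hb using h
    exact ⟨b, funext hb⟩
  · rintro ⟨b, hb⟩ σ
    exact ⟨b σ, congrFun hb σ⟩

theorem horizontal_mem_ker [LinearOrder ι] {k n : ℕ} {a : Cochain R U k n}
    (ha : a ∈ LinearMap.ker (vertical R U k n)) :
    horizontal R U k n a ∈ LinearMap.ker (vertical R U (k + 1) n) := by
  rw [LinearMap.mem_ker] at ha ⊢
  rw [vertical_horizontal, ha, map_zero]

theorem coboundary_classes [LinearOrder ι] (k n : ℕ) (a : LinearMap.ker (vertical R U k n)) :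
    CellularSheaf.coboundary (cechSheaf R U n) k (classes R U k n a) =
      classes R U (k + 1) n ⟨horizontal R U k n a.1, horizontal_mem_ker a.2⟩ := by
  funext τ
  let c : ∀ i : τ.1.1, LinearMap.ker (Singular.coboundary R (coverSupport U τ.1.1) n) := fun i =>
    ⟨restrict R U n (facet_le τ i) (a.1 (facet τ i)), CochainSeq.map_mem_ker
      (Singular.pullback R (ContinuousMap.inclusion (coverSupport_anti U (facet_le τ i))))
      (Singular.pullback_coboundary R _) n _ (congrFun (LinearMap.mem_ker.1 a.2) (facet τ i))⟩
  let q := Submodule.mkQ ((CochainSeq.coboundaries (Singular.coboundary R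
    (coverSupport U τ.1.1)) n).submoduleOf
      (LinearMap.ker (Singular.coboundary R (coverSupport U τ.1.1) n)))
  have h1 : CellularSheaf.coboundary (cechSheaf R U n) k (classes R U k n a) τ =
      ∑ i : τ.1.1, incidence τ i • q (c i) := by
    rw [CellularSheaf.coboundary, LinearMap.pi_apply, LinearMap.sum_apply]
    rfl
  rw [h1]
  have h2 : ∑ i : τ.1.1, incidence τ i • q (c i) = q (∑ i : τ.1.1, incidence τ i • c i) := by
    rw [map_sum]
    exact Finset.sum_congr rfl fun i _ => (map_zsmul q _ _).symm
  rw [h2]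
  refine congrArg q (Subtype.ext ?_)
  change _ = horizontal R U k n a.1 τ
  rw [horizontal_apply]
  simp [c]

/-- The map `Hⁿ(X) → ∏ Hⁿ(U_σ)` to the product over the vertices of the nerve. -/
noncomputable def toVertices (R : Type v) [Field R] (U : ι → Set X) (n : ℕ) :
    Singular.Cohomology R X n →ₗ[R] CellularSheaf.Cochain (cechSheaf R U n) 0 :=
  LinearMap.pi fun σ => Singular.cohomologyMap R (inclusion (coverSupport U σ.1.1)) n

theorem vertical_vertical (k n : ℕ) (a : Cochain R U k n) :
    vertical R U k (n + 1) (vertical R U k n a) = 0 :=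
  funext fun σ => Singular.coboundary_coboundary R n (a σ)

theorem augmentation_mem_ker {n : ℕ} {c : Singular.Cochain R X n}
    (hc : c ∈ LinearMap.ker (Singular.coboundary R X n)) :
    augmentation R U n c ∈ LinearMap.ker (vertical R U 0 n) := by
  rw [LinearMap.mem_ker] at hc ⊢
  rw [vertical_augmentation, hc, map_zero]

theorem toVertices_mk (n : ℕ) (c : LinearMap.ker (Singular.coboundary R X n)) :
    toVertices R U n (Submodule.Quotient.mk c) =
      classes R U 0 n ⟨augmentation R U n c.1, augmentation_mem_ker c.2⟩ := rfl

/-- A family of cocycles which agree on intersections comes from a cocycle on `X`. -/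
theorem exists_cocycle [LinearOrder ι] (hopen : ∀ i, IsOpen (U i)) (hcover : ⋃ i, U i = Set.univ)
    (hdim : ∀ σ ∈ (coverNerve U).faces, σ.card ≤ 2) (n : ℕ) (a : Cochain R U 0 n)
    (ha : horizontal R U 0 n a = 0) (hda : vertical R U 0 n a = 0) :
    ∃ c, Singular.coboundary R X n c = 0 ∧ augmentation R U n c = a := by
  obtain ⟨c, rfl⟩ := exists_augmentation_eq hdim n a ha
  -- The glued cochain `c` need not be a cocycle, but its coboundary restricts to zero on the cover.
  -- Acyclicity supplies a correction `e` that is invisible on the cover.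
  obtain ⟨e, he, hde⟩ := exists_coboundary_eq hopen hcover n (Singular.coboundary R X n c) hda
    (Singular.coboundary_coboundary R n c)
  exact ⟨c - e, by rw [map_sub, hde, sub_self], by rw [map_sub, he, sub_zero]⟩

theorem classes_vertical (k n : ℕ) (b : Cochain R U k n) :
    classes R U k (n + 1) ⟨vertical R U k n b, LinearMap.mem_ker.2 (vertical_vertical k n b)⟩ = 0 :=
  (classes_succ_eq_zero_iff _ _ _).2 ⟨b, rfl⟩

theorem range_toVertices [LinearOrder ι] (hopen : ∀ i, IsOpen (U i)) (hcover : ⋃ i, U i = Set.univ)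
    (hdim : ∀ σ ∈ (coverNerve U).faces, σ.card ≤ 2) (n : ℕ) :
    LinearMap.range (toVertices R U n) =
      LinearMap.ker (CellularSheaf.coboundary (cechSheaf R U n) 0) := by
  apply le_antisymm
  · rintro _ ⟨z, rfl⟩
    obtain ⟨c, rfl⟩ := Submodule.Quotient.mk_surjective _ z
    rw [LinearMap.mem_ker, toVertices_mk, coboundary_classes]
    refine (congrArg (classes R U 1 n) (Subtype.ext ?_)).trans (map_zero _)
    exact horizontal_augmentation n c.1
  · intro z hz
    obtain ⟨a, rfl⟩ := classes_surjective 0 n z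
    rw [LinearMap.mem_ker, coboundary_classes] at hz
    obtain ⟨a', ha', hcl⟩ : ∃ a' : LinearMap.ker (vertical R U 0 n),
        horizontal R U 0 n a'.1 = 0 ∧ classes R U 0 n a' = classes R U 0 n a := by
      cases n with
      -- In degree `0` the only coboundary is zero, so equality of classes is equality of cochains.
      | zero => exact ⟨a, (classes_zero_eq_zero_iff _ _).1 hz, rfl⟩
      | succ n =>
        obtain ⟨b, hb⟩ := (classes_succ_eq_zero_iff _ _ _).1 hz
        obtain ⟨a₁, rfl⟩ := horizontal_surjective hdim n b
        -- The Čech differential of `a` is the coboundary of an edge family, which lifts to `a₁`.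
        -- Subtracting the coboundary of `a₁` keeps the classes and makes the cocycles agree on
        -- overlaps.
        refine ⟨a - ⟨vertical R U 0 n a₁, LinearMap.mem_ker.2 (vertical_vertical 0 n a₁)⟩, ?_, ?_⟩
        · rw [vertical_horizontal] at hb
          exact (map_sub _ _ _).trans (sub_eq_zero.2 hb.symm)
        · rw [map_sub, classes_vertical, sub_zero]
    obtain ⟨c, hc, hca⟩ := exists_cocycle hopen hcover hdim n a'.1 ha' (LinearMap.mem_ker.1 a'.2)
    refine ⟨Submodule.Quotient.mk ⟨c, LinearMap.mem_ker.2 hc⟩, ?_⟩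
    rw [toVertices_mk, ← hcl]
    exact congrArg _ (Subtype.ext hca)

theorem toVertices_zero_injective (hcover : ⋃ i, U i = Set.univ) :
    Function.Injective (toVertices R U 0) := by
  rw [injective_iff_map_eq_zero]
  intro z hz
  obtain ⟨c, rfl⟩ := Submodule.Quotient.mk_surjective _ z
  rw [toVertices_mk, classes_zero_eq_zero_iff] at hz
  rw [Submodule.Quotient.mk_eq_zero]
  exact augmentation_zero_injective hcover c.1 hz

/-- Pairs of a cocycle `c` on `X` and a family of cochains bounding the restrictions of `c` to the
members of the cover. -/
noncomputable def boundedPairs (R : Type v) [Field R] (U : ι → Set X) (n : ℕ) :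
    Submodule R (Singular.Cochain R X (n + 1) × Cochain R U 0 n) :=
  LinearMap.ker (Singular.coboundary R X (n + 1) ∘ₗ LinearMap.fst R _ _) ⊓
    LinearMap.ker (augmentation R U (n + 1) ∘ₗ LinearMap.fst R _ _ -
      vertical R U 0 n ∘ₗ LinearMap.snd R _ _)

theorem mem_boundedPairs {n : ℕ} {y : Singular.Cochain R X (n + 1) × Cochain R U 0 n} :
    y ∈ boundedPairs R U n ↔ Singular.coboundary R X (n + 1) y.1 = 0 ∧
      augmentation R U (n + 1) y.1 = vertical R U 0 n y.2 := by
  simp only [boundedPairs, Submodule.mem_inf, LinearMap.mem_ker, LinearMap.comp_apply,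
    LinearMap.sub_apply, LinearMap.fst_apply, LinearMap.snd_apply, sub_eq_zero]

/-- The class of the first component of a pair. -/
noncomputable def fstClass (R : Type v) [Field R] (U : ι → Set X) (n : ℕ) :
    boundedPairs R U n →ₗ[R] Singular.Cohomology R X (n + 1) :=
  Submodule.mkQ _ ∘ₗ (LinearMap.fst R _ _ ∘ₗ (boundedPairs R U n).subtype).codRestrict _
    fun y => LinearMap.mem_ker.2 (mem_boundedPairs.1 y.2).1

theorem vertical_horizontal_snd [LinearOrder ι] {n : ℕ} (y : boundedPairs R U n) :
    vertical R U 1 n (horizontal R U 0 n y.1.2) = 0 := by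
  rw [vertical_horizontal, ← (mem_boundedPairs.1 y.2).2, horizontal_augmentation]

theorem coboundary_one_eq_zero [LinearOrder ι] (hdim : ∀ σ ∈ (coverNerve U).faces, σ.card ≤ 2) (n : ℕ)
    (z : CellularSheaf.Cochain (cechSheaf R U n) 1) :
    CellularSheaf.coboundary (cechSheaf R U n) 1 z = 0 := by
  funext τ
  have h1 := hdim _ τ.1.2
  have h2 := τ.2
  omega

/-- The class in `H¹` of the Čech differential of the second component of a pair. -/
noncomputable def sndClass [LinearOrder ι] (hdim : ∀ σ ∈ (coverNerve U).faces, σ.card ≤ 2) (n : ℕ) :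
    boundedPairs R U n →ₗ[R] CellularSheaf.Cohomology (cechSheaf R U n) 1 :=
  Submodule.mkQ _ ∘ₗ (classes R U 1 n ∘ₗ (horizontal R U 0 n ∘ₗ LinearMap.snd R _ _ ∘ₗ
    (boundedPairs R U n).subtype).codRestrict _
      fun y => LinearMap.mem_ker.2 (vertical_horizontal_snd y)).codRestrict _
    fun _ => LinearMap.mem_ker.2 (coboundary_one_eq_zero hdim n _)

theorem fstClass_eq_zero_iff {n : ℕ} (y : boundedPairs R U n) :
    fstClass R U n y = 0 ↔ ∃ e, Singular.coboundary R X n e = y.1.1 :=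
  Submodule.Quotient.mk_eq_zero _

theorem sndClass_eq_zero_iff [LinearOrder ι] (hdim : ∀ σ ∈ (coverNerve U).faces, σ.card ≤ 2) {n : ℕ}
    (y : boundedPairs R U n) :
    sndClass hdim n y = 0 ↔ ∃ z, CellularSheaf.coboundary (cechSheaf R U n) 0 z =
      classes R U 1 n ⟨horizontal R U 0 n y.1.2, LinearMap.mem_ker.2 (vertical_horizontal_snd y)⟩ :=
  Submodule.Quotient.mk_eq_zero _

theorem range_fstClass (n : ℕ) :
    LinearMap.range (fstClass R U n) = LinearMap.ker (toVertices R U (n + 1)) := by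
  ext z
  obtain ⟨c, rfl⟩ := Submodule.Quotient.mk_surjective _ z
  rw [LinearMap.mem_ker, toVertices_mk, classes_succ_eq_zero_iff]
  constructor
  · rintro ⟨y, hy⟩
    obtain ⟨e, he⟩ := (Submodule.Quotient.eq _).1 hy
    have hy2 := (mem_boundedPairs.1 y.2).2
    have he' : Singular.coboundary R X n e = y.1.1 - c.1 := he
    -- Replacing the cocycle of `y` by the cohomologous `c` changes the bounding family by the
    -- restriction of `e`.
    refine ⟨y.1.2 - augmentation R U n e, ?_⟩
    rw [map_sub, ← hy2, vertical_augmentation, he', map_sub, sub_sub_cancel]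
  · rintro ⟨b, hb⟩
    exact ⟨⟨(c.1, b), mem_boundedPairs.2 ⟨c.2, hb.symm⟩⟩, rfl⟩

/-- Lift a family of edge cocycles to a vertex family `a`. The coboundary of `a` then agrees on
overlaps and glues to a cocycle on `X` bounded by `a`. -/
theorem sndClass_surjective [LinearOrder ι] (hopen : ∀ i, IsOpen (U i)) (hcover : ⋃ i, U i = Set.univ)
    (hdim : ∀ σ ∈ (coverNerve U).faces, σ.card ≤ 2) (n : ℕ) :
    Function.Surjective (sndClass (R := R) hdim n) := by
  intro z
  obtain ⟨⟨z, hz⟩, rfl⟩ := Submodule.Quotient.mk_surjective _ z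
  obtain ⟨b, rfl⟩ := classes_surjective 1 n z
  obtain ⟨a, ha⟩ := horizontal_surjective hdim n b.1
  obtain ⟨c, hc, hca⟩ := exists_cocycle hopen hcover hdim (n + 1) (vertical R U 0 n a)
    (by rw [← vertical_horizontal, ha]; exact b.2) (vertical_vertical 0 n a)
  refine ⟨⟨(c, a), mem_boundedPairs.2 ⟨hc, hca⟩⟩, ?_⟩
  exact congrArg (Submodule.Quotient.mk) (Subtype.ext (congrArg (classes R U 1 n) (Subtype.ext ha)))

/-- If `c` is the coboundary of `e`, subtracting the restriction of `e` from `b` leaves cocycles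
with the same Čech differential as `b`. Conversely, if the class of that differential is zero, `b`
can be changed by vertical cocycles until it glues to some `e`. Then `c` minus the coboundary of `e`
vanishes on the cover, so acyclicity applies. -/
theorem ker_fstClass_eq_ker_sndClass [LinearOrder ι] (hopen : ∀ i, IsOpen (U i)) (hcover : ⋃ i, U i = Set.univ)
    (hdim : ∀ σ ∈ (coverNerve U).faces, σ.card ≤ 2) (n : ℕ) :
    LinearMap.ker (fstClass R U n) = LinearMap.ker (sndClass hdim n) := by
  ext y
  obtain ⟨hy1, hy2⟩ := mem_boundedPairs.1 y.2
  rw [LinearMap.mem_ker, LinearMap.mem_ker, fstClass_eq_zero_iff, sndClass_eq_zero_iff]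
  constructor
  · rintro ⟨e, he⟩
    have h : vertical R U 0 n (y.1.2 - augmentation R U n e) = 0 := by
      rw [map_sub, ← hy2, vertical_augmentation, he, sub_self]
    refine ⟨classes R U 0 n ⟨_, LinearMap.mem_ker.2 h⟩, ?_⟩
    rw [coboundary_classes]
    refine congrArg _ (Subtype.ext ?_)
    change horizontal R U 0 n (y.1.2 - augmentation R U n e) = horizontal R U 0 n y.1.2
    rw [map_sub, horizontal_augmentation, sub_zero]
  · rintro ⟨z, hz⟩
    obtain ⟨a, rfl⟩ := classes_surjective 0 n z
    rw [coboundary_classes] at hz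
    obtain ⟨a', ha', hda'⟩ : ∃ a', horizontal R U 0 n a' = 0 ∧
        vertical R U 0 n a' = vertical R U 0 n y.1.2 := by
      have hz' := sub_eq_zero.2 hz.symm
      rw [← map_sub] at hz'
      cases n with
      | zero =>
        refine ⟨y.1.2 - a.1, ?_, ?_⟩
        · rw [map_sub]
          exact (classes_zero_eq_zero_iff _ _).1 hz'
        · rw [map_sub, LinearMap.mem_ker.1 a.2, sub_zero]
      | succ n =>
        obtain ⟨b, hb⟩ := (classes_succ_eq_zero_iff _ _ _).1 hz'
        obtain ⟨a₁, rfl⟩ := horizontal_surjective hdim n b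
        -- Both subtracted families are vertical cocycles, so the vertical coboundary is unchanged.
        -- Together they cancel the Čech differential.
        refine ⟨y.1.2 - a.1 - vertical R U 0 n a₁, ?_, ?_⟩
        · rw [map_sub, map_sub, ← vertical_horizontal, hb]
          exact sub_self _
        · rw [map_sub, map_sub, LinearMap.mem_ker.1 a.2, vertical_vertical, sub_zero, sub_zero]
    obtain ⟨e, he⟩ := exists_augmentation_eq hdim n a' ha'
    obtain ⟨e', -, hde'⟩ := exists_coboundary_eq hopen hcover n
      (y.1.1 - Singular.coboundary R X n e)
      (by rw [map_sub, hy2, ← hda', ← he, vertical_augmentation, sub_self])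
      (by rw [map_sub, hy1, Singular.coboundary_coboundary, sub_zero])
    exact ⟨e' + e, by rw [map_add, hde', sub_add_cancel]⟩

end Cech

/-! ### Linear algebra and assembly of the isomorphism -/

/-- Linear maps with the same kernel have isomorphic ranges. -/
noncomputable def LinearMap.rangeEquivOfKerEq {R V M N : Type*} [Ring R] [AddCommGroup V]
    [AddCommGroup M] [AddCommGroup N] [Module R V] [Module R M] [Module R N] (f : V →ₗ[R] M)
    (g : V →ₗ[R] N) (h : LinearMap.ker f = LinearMap.ker g) :
    LinearMap.range f ≃ₗ[R] LinearMap.range g :=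
  f.quotKerEquivRange.symm ≪≫ₗ Submodule.quotEquivOfEq _ _ h ≪≫ₗ g.quotKerEquivRange

/-- The cohomology of a sequence in degree `0` is the kernel of the first map. -/
noncomputable def CochainSeq.cohomologyZeroEquiv {R : Type v} [Ring R] {C : ℕ → Type w}
    [∀ n, AddCommGroup (C n)] [∀ n, Module R (C n)] (d : ∀ n, C n →ₗ[R] C (n + 1)) :
    Cohomology d 0 ≃ₗ[R] LinearMap.ker (d 0) :=
  Submodule.quotEquivOfEqBot _ (Submodule.ker_subtype _)

theorem proposition5p3 (R : Type v) [Field R] (X : Type u) [TopologicalSpace X]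
    {ι : Type w} [Finite ι] [LinearOrder ι] (U : ι → Set X)
    (hopen : ∀ i, IsOpen (U i)) (hcover : ⋃ i, U i = Set.univ)
    (hdim : ∀ σ ∈ (coverNerve U).faces, σ.card ≤ 2) :
    Nonempty (Singular.Cohomology R X 0 ≃ₗ[R]
        CellularSheaf.Cohomology (cechSheaf R U 0) 0) ∧
      ∀ n : ℕ, Nonempty (Singular.Cohomology R X (n + 1) ≃ₗ[R]
        (CellularSheaf.Cohomology (cechSheaf R U (n + 1)) 0 ×
          CellularSheaf.Cohomology (cechSheaf R U n) 1)) := by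
  have e₀ (n : ℕ) : LinearMap.range (Cech.toVertices R U n) ≃ₗ[R]
      CellularSheaf.Cohomology (cechSheaf R U n) 0 :=
    LinearEquiv.ofEq _ _ (Cech.range_toVertices hopen hcover hdim n) ≪≫ₗ
      (CochainSeq.cohomologyZeroEquiv _).symm
  refine ⟨⟨LinearEquiv.ofInjective _ (Cech.toVertices_zero_injective hcover) ≪≫ₗ e₀ 0⟩,
    fun n => ?_⟩
  have e₁ : LinearMap.ker (Cech.toVertices R U (n + 1)) ≃ₗ[R]
      CellularSheaf.Cohomology (cechSheaf R U n) 1 :=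
    LinearEquiv.ofEq _ _ (Cech.range_fstClass n).symm ≪≫ₗ
      LinearMap.rangeEquivOfKerEq _ _ (Cech.ker_fstClass_eq_ker_sndClass hopen hcover hdim n) ≪≫ₗ
      LinearEquiv.ofTop _ (LinearMap.range_eq_top.2 (Cech.sndClass_surjective hopen hcover hdim n))
  -- The splitting: the cohomology of `X` is the product of the kernel of `toVertices` and the
  -- quotient by it.
  obtain ⟨e⟩ := quotient_prod_linearEquiv (LinearMap.ker (Cech.toVertices R U (n + 1)))
  exact ⟨e.symm ≪≫ₗ LinearEquiv.prodCongr
    ((Cech.toVertices R U (n + 1)).quotKerEquivRange ≪≫ₗ e₀ (n + 1)) e₁⟩
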